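/- Let $G$ and $H$ be Lie groups (smooth, modelled on real Banach spaces, possibly infinite-dimensional) with Lie algebras $\mathfrak g$ and $\mathfrak h$, equipped with the right invariant Riemannian metrics given by bounded, symmetric, positive definite bilinear forms $\langle\cdot,\cdot\rangle$ on $\mathfrak g$ and $\mathfrak h$ (weak inner products: they need not induce the given topology). Let $B$ be an action of $G$ on $H$ by group automorphisms such that $G\times H\to H$, $(g,k)\mapsto B(g)k$, is smooth, let $\beta(g)=T_eB(g)\in\mathrm{Aut}(\mathfrak h)$, and let $b:\mathfrak g\to\mathrm{Der}(\mathfrak h)$ be the derivative of $\beta$ at the identity. The semidirect product $G\ltimes H$ is the manifold $G\times H$ with group operation $(g_1,k_1)(g_2,k_2)=(g_1g_2,\,k_1\,B(g_1)k_2)$; it carries the right invariant metric given on its Lie algebra $\mathfrak g\ltimes\mathfrak h$ by $\langle (X_1,Y_1),(X_2,Y_2)\rangle=\langle X_1,X_2\rangle+\langle Y_1,Y_2\rangle$. Assume that the transposes $\mathrm{ad}(X)^\top$, $\mathrm{ad}(Y)^\top$ and $b(X)^\top$ with respect to these inner products exist for all $X\in\mathfrak g$, $Y\in\mathfrak h$,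 and that there is a bilinear map $h:\mathfrak h\times\mathfrak h\to\mathfrak g$ with $\langle b(X)Y_1,Y_2\rangle=\langle h(Y_1,Y_2),X\rangle$ for all $X,Y_1,Y_2$. Then $G$, $H$ and $G\ltimes H$ have Levi-Civita covariant derivatives. Write $\mathcal R^G,\mathcal R^H,\tilde{\mathcal R}$ for their curvature tensors $\mathcal R(U,V)W=\nabla_U\nabla_VW-\nabla_V\nabla_UW-\nabla_{[U,V]}W$, evaluated on right invariant vector fields and read in the right trivialization. At every point the following holds. 1. For $X_1,X_2\in\mathfrak g$, $$\langle\tilde{\mathcal R}((X_1,0),(X_2,0))(X_2,0),(X_1,0)\rangle=\langle\mathcal R^G(X_1,X_2)X_2,X_1\rangle.$$ 2. For $X\in\mathfrak g$, $Y\in\mathfrak h$, $$\langle\tilde{\mathcal R}((X,0),(0,Y))(0,Y),(X,0)\rangle=\langle h(Y,Y),\mathrm{ad}(X)^\top X\rangle-\tfrac14\|(b(X)+b(X)^\top)Y\|^2+\tfrac12\|b(X)^\top Y\|^2-\tfrac12\|b(X)Y\|^2.$$ 3. For $Y_1,Y_2\in\mathfrak h$, $$\langle\tilde{\mathcal R}((0,Y_1),(0,Y_2))(0,Y_2),(0,Y_1)\rangle=\langle\mathcal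 R^H(Y_1,Y_2)Y_2,Y_1\rangle+\tfrac14\|h(Y_1,Y_2)+h(Y_2,Y_1)\|^2-\langle h(Y_1,Y_1),h(Y_2,Y_2)\rangle.$$ In each case, if the two vectors are linearly independent, the sign of the sectional curvature $$\mathcal K(U,V)=\frac{\langle\tilde{\mathcal R}(U,V)V,U\rangle}{\langle U,U\rangle\langle V,V\rangle-\langle U,V\rangle^2}$$ of the plane they span is the sign of the right-hand side. The same statements hold at the level of Lie algebras, which covers Lie groups with more general model spaces: let $\mathfrak g,\mathfrak h$ be any real Lie algebras with symmetric positive definite bilinear forms, let $b:\mathfrak g\to\mathrm{Der}(\mathfrak h)$ be a Lie algebra homomorphism, and assume that the transposes and $h$ exist as above. Then the transposes of $\mathrm{ad}(X,Y)$ exist on $\mathfrak g\ltimes\mathfrak h$, with bracket $[(X_1,Y_1),(X_2,Y_2)]=([X_1,X_2],[Y_1,Y_2]+b(X_1)Y_2-b(X_2)Y_1)$. Formulas 1–3 and the assertions on signs hold when $\mathcal R^G,\mathcal R^H,\tilde{\mathcal R}$ denote the curvatures of right invariant metrics expressed in the Lie algebras $\mathfrak g$, $\mathfrak h$, $\mathfrak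 g\ltimes\mathfrak h$, namely $\mathcal R(U,V)W=\nabla_U\nabla_VW-\nabla_V\nabla_UW+\nabla_{[U,V]}W$ with $\nabla_UV=\tfrac12\bigl(\mathrm{ad}(U)^\top V+\mathrm{ad}(V)^\top U-\mathrm{ad}(U)V\bigr)$. -/

import Mathlib

open scoped Manifold ContDiff

noncomputable section

/-! ### Inner products, transposes, sectional curvature -/

/-- A bilinear form is a (possibly weak) inner product: symmetric and positive definite. -/
structure IsInnerProductForm {V : Type*} [AddCommGroup V] [Module ℝ V]
    (B : LinearMap.BilinForm ℝ V) : Prop where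
  symm : ∀ u v : V, B u v = B v u
  pos : ∀ v : V, v ≠ 0 → 0 < B v v

/-- `A'` is the transpose of `A` with respect to the form `B`. -/
def IsTransposeOf {V : Type*} [AddCommGroup V] [Module ℝ V]
    (B : LinearMap.BilinForm ℝ V) (A' A : V → V) : Prop :=
  ∀ u v : V, B (A' u) v = B u (A v)

/-- The number `⟨R(u, v) v, u⟩`. -/
def curvatureForm {V : Type*} [AddCommGroup V] [Module ℝ V]
    (B : LinearMap.BilinForm ℝ V) (R : V → V → V → V) (u v : V) : ℝ :=
  B (R u v v) u

/-- The sectional curvature `⟨R(u, v) v, u⟩ / (⟨u, u⟩ ⟨v, v⟩ - ⟨u, v⟩ ^ 2)`. -/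
def sectionalCurvature {V : Type*} [AddCommGroup V] [Module ℝ V]
    (B : LinearMap.BilinForm ℝ V) (R : V → V → V → V) (u v : V) : ℝ :=
  curvatureForm B R u v / (B u u * B v v - B u v ^ 2)

/-- The orthogonal sum of two bilinear forms. -/
def orthogonalSum {V W : Type*} [AddCommGroup V] [Module ℝ V] [AddCommGroup W] [Module ℝ W]
    (B : LinearMap.BilinForm ℝ V) (C : LinearMap.BilinForm ℝ W) :
    LinearMap.BilinForm ℝ (V × W) :=
  B.compl₁₂ (LinearMap.fst ℝ V W) (LinearMap.fst ℝ V W) +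
    C.compl₁₂ (LinearMap.snd ℝ V W) (LinearMap.snd ℝ V W)

/-- The curvature formulas for a right invariant metric on a semidirect product. Here `𝔤`, `𝔥` and
`𝔰` are the Lie algebras of the factors and of the semidirect product, with inner products `ipG`,
`ipH`, `ipS` and curvature tensors `RG`, `RH`, `RS`; `pair X Y` is the element `(X, Y)` of `𝔰`,
`adTG X` the transpose of `ad X` on `𝔤`, `b` the infinitesimal action of `𝔤` on `𝔥`, `bT X` the
transpose of `b X`, and `h` the map with `⟨b(X) Y₁, Y₂⟩ = ⟨h(Y₁, Y₂), X⟩`. -/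
structure SemidirectCurvatureFormulas
    {𝔤 𝔥 𝔰 : Type*} [AddCommGroup 𝔤] [Module ℝ 𝔤] [AddCommGroup 𝔥] [Module ℝ 𝔥]
    [AddCommGroup 𝔰] [Module ℝ 𝔰]
    (ipG : LinearMap.BilinForm ℝ 𝔤) (RG : 𝔤 → 𝔤 → 𝔤 → 𝔤)
    (ipH : LinearMap.BilinForm ℝ 𝔥) (RH : 𝔥 → 𝔥 → 𝔥 → 𝔥)
    (ipS : LinearMap.BilinForm ℝ 𝔰) (RS : 𝔰 → 𝔰 → 𝔰 → 𝔰) (pair : 𝔤 → 𝔥 → 𝔰)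
    (adTG : 𝔤 → 𝔤 → 𝔤) (b bT : 𝔤 → 𝔥 → 𝔥) (h : 𝔥 →ₗ[ℝ] 𝔥 →ₗ[ℝ] 𝔤) : Prop where
  /-- Planes spanned by `(X₁, 0)` and `(X₂, 0)`. -/
  base : ∀ X₁ X₂ : 𝔤,
    curvatureForm ipS RS (pair X₁ 0) (pair X₂ 0) = curvatureForm ipG RG X₁ X₂
  base_sign : ∀ X₁ X₂ : 𝔤, LinearIndependent ℝ ![pair X₁ 0, pair X₂ 0] →
    SignType.sign (sectionalCurvature ipS RS (pair X₁ 0) (pair X₂ 0)) =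
      SignType.sign (curvatureForm ipG RG X₁ X₂)
  /-- Planes spanned by `(X, 0)` and `(0, Y)`. -/
  mixed : ∀ (X : 𝔤) (Y : 𝔥),
    curvatureForm ipS RS (pair X 0) (pair 0 Y) =
      ipG (h Y Y) (adTG X X)
        - (1 / 4) * ipH (b X Y + bT X Y) (b X Y + bT X Y)
        + (1 / 2) * ipH (bT X Y) (bT X Y) - (1 / 2) * ipH (b X Y) (b X Y)
  mixed_sign : ∀ (X : 𝔤) (Y : 𝔥), LinearIndependent ℝ ![pair X 0, pair 0 Y] →
    SignType.sign (sectionalCurvature ipS RS (pair X 0) (pair 0 Y)) =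
      SignType.sign (ipG (h Y Y) (adTG X X)
        - (1 / 4) * ipH (b X Y + bT X Y) (b X Y + bT X Y)
        + (1 / 2) * ipH (bT X Y) (bT X Y) - (1 / 2) * ipH (b X Y) (b X Y))
  /-- Planes spanned by `(0, Y₁)` and `(0, Y₂)`. -/
  fiber : ∀ Y₁ Y₂ : 𝔥,
    curvatureForm ipS RS (pair 0 Y₁) (pair 0 Y₂) =
      curvatureForm ipH RH Y₁ Y₂
        + (1 / 4) * ipG (h Y₁ Y₂ + h Y₂ Y₁) (h Y₁ Y₂ + h Y₂ Y₁)
        - ipG (h Y₁ Y₁) (h Y₂ Y₂)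
  fiber_sign : ∀ Y₁ Y₂ : 𝔥, LinearIndependent ℝ ![pair 0 Y₁, pair 0 Y₂] →
    SignType.sign (sectionalCurvature ipS RS (pair 0 Y₁) (pair 0 Y₂)) =
      SignType.sign (curvatureForm ipH RH Y₁ Y₂
        + (1 / 4) * ipG (h Y₁ Y₂ + h Y₂ Y₁) (h Y₁ Y₂ + h Y₂ Y₁)
        - ipG (h Y₁ Y₁) (h Y₂ Y₂))

/-! ### Levi-Civita derivatives and curvature on manifolds -/

section Manifold

variable {E : Type*} [NormedAddCommGroup E] [NormedSpace ℝ E]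
  {HM : Type*} [TopologicalSpace HM] {I : ModelWithCorners ℝ E HM}
  {M : Type*} [TopologicalSpace M] [ChartedSpace HM M] [IsManifold I 1 M]

/-- `cov` is a Levi-Civita covariant derivative of the (weak) Riemannian metric `g`:
torsion free and compatible with `g`. In Mathlib's convention `cov Y x (X x)` is `(∇_X Y)(x)`. -/
structure IsLeviCivita (g : ∀ x : M, TangentSpace I x → TangentSpace I x → ℝ)
    (cov : CovariantDerivative I E (TangentSpace I : M → Type _)) : Prop where
  torsion_free : ∀ (X Y : ∀ x : M, TangentSpace I x) (x : M),
    MDiffAt (T% X) x → MDiffAt (T% Y) x →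
      cov Y x (X x) - cov X x (Y x) = VectorField.mlieBracket I X Y x
  metric : ∀ (X Y Z : ∀ x : M, TangentSpace I x) (x : M),
    MDiffAt (T% Y) x → MDiffAt (T% Z) x →
      mvfderiv I (fun y => g y (Y y) (Z y)) x (X x) =
        g x (cov Y x (X x)) (Z x) + g x (Y x) (cov Z x (X x))

/-- The curvature `R(X, Y) Z = ∇_X ∇_Y Z - ∇_Y ∇_X Z - ∇_[X, Y] Z` of vector fields. -/
def riemannCurvature (cov : CovariantDerivative I E (TangentSpace I : M → Type _))
    (X Y Z : ∀ x : M, TangentSpace I x) (x : M) : TangentSpace I x :=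
  cov (fun y => cov Z y (Y y)) x (X x) - cov (fun y => cov Z y (X y)) x (Y x)
    - cov Z x (VectorField.mlieBracket I X Y x)

end Manifold

/-! ### Right invariant metrics on Lie groups -/

section Group

variable {E : Type*} [NormedAddCommGroup E] [NormedSpace ℝ E]
  {HM : Type*} [TopologicalSpace HM] {I : ModelWithCorners ℝ E HM}
  {G : Type*} [TopologicalSpace G] [ChartedSpace HM G] [Group G]

/-- The right trivialization `T_x G → T_1 G`, the derivative of `y ↦ y * x⁻¹` at `x`. -/
def rightTriv (x : G) : TangentSpace I x →L[ℝ] GroupLieAlgebra I G :=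
  mfderiv I I (fun y : G => y * x⁻¹) x

/-- The right invariant vector field with value `v` at the identity. -/
def rightInvariantField (v : GroupLieAlgebra I G) (x : G) : TangentSpace I x :=
  mfderiv I I (fun y : G => y * x) 1 v

/-- The right invariant metric on `G` given by the form `B` at the identity. -/
def rightInvariantMetric (B : LinearMap.BilinForm ℝ (GroupLieAlgebra I G)) (x : G)
    (u v : TangentSpace I x) : ℝ :=
  B (rightTriv x u) (rightTriv x v)

/-- The curvature tensor at the point `x` in the right trivialization, a trilinear operation on
the Lie algebra. -/
def trivCurvature [IsManifold I 1 G]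
    (cov : CovariantDerivative I E (TangentSpace I : G → Type _)) (x : G)
    (u v w : GroupLieAlgebra I G) : GroupLieAlgebra I G :=
  rightTriv x (riemannCurvature cov (rightInvariantField u) (rightInvariantField v)
    (rightInvariantField w) x)

end Group

/-! ### Semidirect products of Lie groups -/

section Semidirect

/-- The underlying manifold `G × H` of the semidirect product of `G` and `H`, where `G` acts on
`H` by `B`. -/
@[nolint unusedArguments]
def SemidirectGroup {G H : Type*} [Group G] [Group H] (_B : G →* MulAut H) : Type _ := G × H

variable {G H : Type*} [Group G] [Group H] (B : G →* MulAut H)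

/-- The group operation `(g₁, h₁) (g₂, h₂) = (g₁ g₂, h₁ B(g₁) h₂)`. -/
instance : Group (SemidirectGroup B) where
  mul p q := (p.1 * q.1, p.2 * B p.1 q.2)
  one := ((1 : G), (1 : H))
  inv p := (p.1⁻¹, B p.1⁻¹ p.2⁻¹)
  mul_assoc p q r := Prod.ext (mul_assoc p.1 q.1 r.1) (by
    change p.2 * B p.1 q.2 * B (p.1 * q.1) r.2 = p.2 * B p.1 (q.2 * B q.1 r.2)
    simp [mul_assoc])
  one_mul p := Prod.ext (one_mul p.1) (by
    change 1 * B 1 p.2 = p.2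
    simp)
  mul_one p := Prod.ext (mul_one p.1) (by
    change p.2 * B p.1 1 = p.2
    simp)
  inv_mul_cancel p := Prod.ext (inv_mul_cancel p.1) (by
    change B p.1⁻¹ p.2⁻¹ * B p.1⁻¹ p.2 = 1
    simp)

variable {E : Type*} [NormedAddCommGroup E] [NormedSpace ℝ E]
  {HM : Type*} [TopologicalSpace HM] {I : ModelWithCorners ℝ E HM}
  {F : Type*} [NormedAddCommGroup F] [NormedSpace ℝ F]
  {HN : Type*} [TopologicalSpace HN] {J : ModelWithCorners ℝ F HN}
  [TopologicalSpace G] [ChartedSpace HM G] [TopologicalSpace H] [ChartedSpace HN H]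

instance : TopologicalSpace (SemidirectGroup B) :=
  inferInstanceAs (TopologicalSpace (G × H))

instance : ChartedSpace (ModelProd HM HN) (SemidirectGroup B) :=
  inferInstanceAs (ChartedSpace (ModelProd HM HN) (G × H))

instance {n : ℕ∞ω} [IsManifold I n G] [IsManifold J n H] :
    IsManifold (I.prod J) n (SemidirectGroup B) :=
  inferInstanceAs (IsManifold (I.prod J) n (G × H))

variable (I J) in
/-- The tangent space of the semidirect product at the identity is the product of the two Lie
algebras. -/
def semidirectTangent :
    GroupLieAlgebra (I.prod J) (SemidirectGroup B) ≃ₗ[ℝ]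
      GroupLieAlgebra I G × GroupLieAlgebra J H :=
  LinearEquiv.refl ℝ (E × F)

variable (I J) in
/-- The element `(X, Y)` of the Lie algebra of the semidirect product. -/
def semidirectPair (X : GroupLieAlgebra I G) (Y : GroupLieAlgebra J H) :
    GroupLieAlgebra (I.prod J) (SemidirectGroup B) :=
  (semidirectTangent B I J).symm (X, Y)

/-- The inner product `⟨(X₁, Y₁), (X₂, Y₂)⟩ = ⟨X₁, X₂⟩ + ⟨Y₁, Y₂⟩` on the Lie algebra of the
semidirect product. -/
def semidirectForm (BG : LinearMap.BilinForm ℝ (GroupLieAlgebra I G))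
    (BH : LinearMap.BilinForm ℝ (GroupLieAlgebra J H)) :
    LinearMap.BilinForm ℝ (GroupLieAlgebra (I.prod J) (SemidirectGroup B)) :=
  (orthogonalSum BG BH).compl₁₂ (semidirectTangent B I J).toLinearMap
    (semidirectTangent B I J).toLinearMap

variable (J) in
/-- The linearized action `β(g) = T_1 B(g)` of `g : G` on the Lie algebra of `H`. -/
def linearizedAction (g : G) : GroupLieAlgebra J H →L[ℝ] GroupLieAlgebra J H :=
  mfderiv J J (fun y : H => B g y) 1

variable (I J) in
/-- The infinitesimal action `b(X) Y`, the derivative of `g ↦ β(g) Y` at the identity in the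
direction `X`. -/
def infinitesimalAction (X : GroupLieAlgebra I G) (Y : GroupLieAlgebra J H) :
    GroupLieAlgebra J H :=
  mvfderiv I (F := F) (fun g : G => linearizedAction B J g Y) 1 X

end Semidirect

/-! ### Curvature of a right invariant metric in terms of the Lie algebra -/

section Algebra

variable {L : Type*} [LieRing L] [LieAlgebra ℝ L]

/-- The Levi-Civita derivative `∇_X Y` of right invariant vector fields in the right
trivialization, where `adT X` is the transpose of `ad X`. -/
def algNabla (adT : L → L → L) (X Y : L) : L :=
  (2⁻¹ : ℝ) • (adT X Y + adT Y X - ⁅X, Y⁆)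

/-- The curvature `R(X, Y) Z = ∇_X ∇_Y Z - ∇_Y ∇_X Z + ∇_[X, Y] Z` of right invariant vector
fields in the right trivialization. The last sign is due to the fact that the bracket of the
right invariant fields of `X` and `Y` is the right invariant field of `-⁅X, Y⁆`. -/
def algCurvature (adT : L → L → L) (X Y Z : L) : L :=
  algNabla adT X (algNabla adT Y Z) - algNabla adT Y (algNabla adT X Z)
    + algNabla adT ⁅X, Y⁆ Z

variable {K : Type*} [LieRing K] [LieAlgebra ℝ K] (b : L →ₗ⁅ℝ⁆ LieDerivation ℝ K K)

/-- The element `(X, Y)` of the semidirect product of Lie algebras. -/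
def algPair (X : L) (Y : K) : K ⋊⁅b⁆ L := ⟨Y, X⟩

/-- The inner product `⟨(X₁, Y₁), (X₂, Y₂)⟩ = ⟨X₁, X₂⟩ + ⟨Y₁, Y₂⟩` on the semidirect product of
Lie algebras. -/
def algForm (BL : LinearMap.BilinForm ℝ L) (BK : LinearMap.BilinForm ℝ K) :
    LinearMap.BilinForm ℝ (K ⋊⁅b⁆ L) :=
  (orthogonalSum BK BL).compl₁₂ (LieAlgebra.SemiDirectSum.toProdl b).toLinearMap
    (LieAlgebra.SemiDirectSum.toProdl b).toLinearMap

end Algebra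

end

/-! A right invariant metric has constant coefficients on right invariant fields. Koszul's argument
(`eq_algNabla`) therefore determines a Levi-Civita derivative on these fields: it is the algebraic
operation `algNabla`. The derivative of one right invariant field along another is again right
invariant, so derivatives iterate, and the curvature in the right trivialization is the same map
`algCurvature` at every point (`trivCurvature_eq_algCurvature`). This reduces the group statement to
Lie algebras.

In the semidirect product, `ad(X₁, Y₁)ᵀ(X₂, Y₂) = (ad(X₁)ᵀX₂ - h(Y₁, Y₂), ad(Y₁)ᵀY₂ + b(X₁)ᵀY₂)`,
which yields a closed formula for `∇`. It shows that `G` is totally geodesic, whence formula 1, and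
that `H` has second fundamental form `-½(h(Y₁, Y₂) + h(Y₂, Y₁))`, so that formula 3 is the Gauss
equation. Formula 2 is a direct expansion. The signs follow from strict Cauchy-Schwarz.

The analytic part provides the Levi-Civita derivatives and the bracket of the semidirect product. It
rests on Cartan's formula (`mvfderiv_form_sub`): the exterior derivative of the right trivialization
`ω` is tensorial, so its value on right invariant fields gives the Maurer-Cartan equation. Then
`ω(∇_X σ) = X·ω(σ) + ∇^alg_{ω(X)} ω(σ)` defines a Levi-Civita derivative; its continuity in `X`
comes from the closed graph theorem. Evaluated on a right and a left invariant field, which commute,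
Maurer-Cartan says that the bracket is the derivative of `Ad`. Since conjugation by `g` acts on `H`
as `B(g)`, the mixed bracket is `b(X)Y`. -/

open Set Filter Topology

/-! ### Weak inner products and transposes -/

section InnerProduct

variable {V : Type*} [AddCommGroup V] [Module ℝ V] {B : LinearMap.BilinForm ℝ V}

/-- A weak inner product gives no Riesz representation, only injectivity of `v ↦ ⟨v, ·⟩`. Uniqueness
and linearity of transposes come from this. -/
theorem IsInnerProductForm.ext_left (hB : IsInnerProductForm B) {u v : V}
    (h : ∀ w, B u w = B v w) : u = v := by
  by_contra hne
  have h1 := hB.pos (u - v) (sub_ne_zero.2 hne)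
  rw [map_sub B, LinearMap.sub_apply, h, sub_self] at h1
  exact lt_irrefl _ h1

/-- Strict Cauchy-Schwarz: the squared length of `⟨v, v⟩u - ⟨u, v⟩v`, a nonzero vector by
independence, is `⟨v, v⟩` times the Gram determinant. -/
theorem IsInnerProductForm.gram_pos (hB : IsInnerProductForm B) {u v : V}
    (h : LinearIndependent ℝ ![u, v]) : 0 < B u u * B v v - B u v ^ 2 := by
  have hv : v ≠ 0 := h.ne_zero 1
  have hvv := hB.pos v hv
  have hne : B v v • u - B u v • v ≠ 0 := by
    intro h0
    have := (LinearIndependent.pair_iff.1 h) (B v v) (-B u v) (by rw [neg_smul, ← sub_eq_add_neg, h0])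
    exact hvv.ne' this.1
  have h1 := hB.pos _ hne
  have h2 : B (B v v • u - B u v • v) (B v v • u - B u v • v)
      = B v v * (B u u * B v v - B u v ^ 2) := by
    simp only [map_sub, map_smul, LinearMap.sub_apply, LinearMap.smul_apply, smul_eq_mul,
      hB.symm v u]
    ring
  rw [h2] at h1
  exact (mul_pos_iff_of_pos_left hvv).1 h1

theorem IsInnerProductForm.sign_sectionalCurvature (hB : IsInnerProductForm B)
    (R : V → V → V → V) {u v : V} (h : LinearIndependent ℝ ![u, v]) :
    SignType.sign (sectionalCurvature B R u v) = SignType.sign (curvatureForm B R u v) := by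
  have h1 := hB.gram_pos h
  rw [sectionalCurvature, div_eq_mul_inv, sign_mul, sign_pos (inv_pos.2 h1), mul_one]

theorem IsInnerProductForm.orthogonalSum {W : Type*} [AddCommGroup W] [Module ℝ W]
    {C : LinearMap.BilinForm ℝ W} (hB : IsInnerProductForm B) (hC : IsInnerProductForm C) :
    IsInnerProductForm (orthogonalSum B C) where
  symm u v := by simp [_root_.orthogonalSum, hB.symm u.1, hC.symm u.2]
  pos u hu := by
    have h1 : 0 ≤ B u.1 u.1 := by
      by_cases h : u.1 = 0
      · simp [h]
      · exact (hB.pos _ h).le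
    have h2 : 0 ≤ C u.2 u.2 := by
      by_cases h : u.2 = 0
      · simp [h]
      · exact (hC.pos _ h).le
    have : 0 < B u.1 u.1 ∨ 0 < C u.2 u.2 := by
      by_cases h : u.1 = 0
      · refine .inr (hC.pos _ fun h' => hu (Prod.ext h h'))
      · exact .inl (hB.pos _ h)
    simp only [_root_.orthogonalSum, LinearMap.add_apply, LinearMap.compl₁₂_apply,
      LinearMap.fst_apply, LinearMap.snd_apply]
    rcases this with h | h <;> linarith

theorem IsInnerProductForm.comp_equiv {W : Type*} [AddCommGroup W] [Module ℝ W]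
    (hB : IsInnerProductForm B) (e : W ≃ₗ[ℝ] V) :
    IsInnerProductForm (B.compl₁₂ e.toLinearMap e.toLinearMap) where
  symm u v := hB.symm _ _
  pos u hu := hB.pos _ (by simpa using hu)

theorem IsTransposeOf.map_add (hB : IsInnerProductForm B) {A' A : V → V}
    (h : IsTransposeOf B A' A) (u v : V) : A' (u + v) = A' u + A' v :=
  hB.ext_left fun w => by simp [h _ _]

theorem IsTransposeOf.map_smul (hB : IsInnerProductForm B) {A' A : V → V}
    (h : IsTransposeOf B A' A) (c : ℝ) (u : V) : A' (c • u) = c • A' u :=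
  hB.ext_left fun w => by simp [h _ _]

end InnerProduct

/-! ### The algebraic Levi-Civita derivative -/

section Nabla

variable {L : Type*} [LieRing L] [LieAlgebra ℝ L] {B : LinearMap.BilinForm ℝ L}
  {adT : L → L → L}

theorem algNabla_add_right (hB : IsInnerProductForm B)
    (hT : ∀ X, IsTransposeOf B (adT X) (fun Z => ⁅X, Z⁆)) (u v w : L) :
    algNabla adT u (v + w) = algNabla adT u v + algNabla adT u w :=
  hB.ext_left fun z => by simp [algNabla, hT _ _ _]; ring

theorem algNabla_smul_right (hB : IsInnerProductForm B)
    (hT : ∀ X, IsTransposeOf B (adT X) (fun Z => ⁅X, Z⁆)) (c : ℝ) (u v : L) :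
    algNabla adT u (c • v) = c • algNabla adT u v :=
  hB.ext_left fun z => by simp [algNabla, hT _ _ _]; ring

theorem algNabla_add_left (hB : IsInnerProductForm B)
    (hT : ∀ X, IsTransposeOf B (adT X) (fun Z => ⁅X, Z⁆)) (u v w : L) :
    algNabla adT (u + v) w = algNabla adT u w + algNabla adT v w :=
  hB.ext_left fun z => by simp [algNabla, hT _ _ _]; ring

theorem algNabla_smul_left (hB : IsInnerProductForm B)
    (hT : ∀ X, IsTransposeOf B (adT X) (fun Z => ⁅X, Z⁆)) (c : ℝ) (u v : L) :
    algNabla adT (c • u) v = c • algNabla adT u v :=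
  hB.ext_left fun z => by simp [algNabla, hT _ _ _]; ring

theorem algNabla_sub_swap (adT : L → L → L) (u v : L) :
    algNabla adT u v - algNabla adT v u = -⁅u, v⁆ := by
  have : ⁅v, u⁆ = -⁅u, v⁆ := (lie_skew v u).symm
  simp only [algNabla, this]
  module

theorem algNabla_metric (hB : IsInnerProductForm B)
    (hT : ∀ X, IsTransposeOf B (adT X) (fun Z => ⁅X, Z⁆)) (u v w : L) :
    B (algNabla adT u v) w + B v (algNabla adT u w) = 0 := by
  rw [hB.symm v]
  have h1 : ⁅w, v⁆ = -⁅v, w⁆ := (lie_skew w v).symm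
  simp only [algNabla, hT _ _ _, h1, map_add, map_sub, map_smul, map_neg,
    LinearMap.add_apply, LinearMap.sub_apply, LinearMap.smul_apply, smul_eq_mul]
  have e1 := hB.symm v ⁅u, w⁆
  have e2 := hB.symm w ⁅u, v⁆
  linarith

/-- Koszul's argument: a metric and torsion free operation is `algNabla`. -/
theorem eq_algNabla (hB : IsInnerProductForm B)
    (hT : ∀ X, IsTransposeOf B (adT X) (fun Z => ⁅X, Z⁆)) {N : L → L → L}
    (htor : ∀ u v, N u v - N v u = -⁅u, v⁆)
    (hmet : ∀ u v w, B (N u v) w + B v (N u w) = 0) : N = algNabla adT := by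
  funext u v
  refine hB.ext_left fun w => ?_
  have t (a b c : L) : B (N a b) c - B (N b a) c = -B ⁅a, b⁆ c := by
    rw [← LinearMap.sub_apply, ← map_sub, htor, map_neg]; rfl
  -- Metricity for the three cyclic orders of `u, v, w`, combined with the three torsion identities,
  -- isolates `⟨N u v, w⟩`.
  have e1 := hmet u v w
  have e2 := hmet v w u
  have e3 := hmet w u v
  have t1 := t u v w
  have t2 := t v w u
  have t3 := t w u v
  have h2 : ⁅w, u⁆ = -⁅u, w⁆ := (lie_skew w u).symm
  simp only [algNabla, hT _ _ _, map_add, map_sub, map_smul, LinearMap.add_apply,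
    LinearMap.sub_apply, LinearMap.smul_apply, smul_eq_mul]
  rw [h2, map_neg] at t3
  have s4 := hB.symm u ⁅v, w⁆
  have s5 := hB.symm v ⁅u, w⁆
  rw [LinearMap.neg_apply] at t3
  have s1 := hB.symm v (N u w)
  have s2 := hB.symm w (N v u)
  have s3 := hB.symm u (N w v)
  linarith

end Nabla

/-! ### Curvature of a semidirect product of Lie algebras -/

section Semidirect

variable {𝔤 𝔥 𝔰 : Type*} [LieRing 𝔤] [LieAlgebra ℝ 𝔤] [LieRing 𝔥] [LieAlgebra ℝ 𝔥]
  [LieRing 𝔰] [LieAlgebra ℝ 𝔰] {e : 𝔰 ≃ₗ[ℝ] 𝔤 × 𝔥}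
  {ipG : LinearMap.BilinForm ℝ 𝔤} {ipH : LinearMap.BilinForm ℝ 𝔥} {ipS : LinearMap.BilinForm ℝ 𝔰}
  {adTG : 𝔤 → 𝔤 → 𝔤} {adTH : 𝔥 → 𝔥 → 𝔥} {adTS : 𝔰 → 𝔰 → 𝔰} {b bT : 𝔤 → 𝔥 → 𝔥}
  {h : 𝔥 →ₗ[ℝ] 𝔥 →ₗ[ℝ] 𝔤}

/-- The map `h` enters because `-⟨Y₂, b(W)Y₁⟩ = -⟨h(Y₁, Y₂), W⟩`. The algebra `𝔰` is known only
through an isomorphism `e` and its bracket, so that this serves both the tangent space of the group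
and the algebraic semidirect sum. -/
theorem isTransposeOf_semidirect
    (hS : ∀ u v, ipS u v = ipG (e u).1 (e v).1 + ipH (e u).2 (e v).2)
    (hbr : ∀ u v : 𝔰, e ⁅u, v⁆ =
      (⁅(e u).1, (e v).1⁆, ⁅(e u).2, (e v).2⁆ + b (e u).1 (e v).2 - b (e v).1 (e u).2))
    (hH : IsInnerProductForm ipH)
    (hTG : ∀ X, IsTransposeOf ipG (adTG X) (fun Z => ⁅X, Z⁆))
    (hTH : ∀ X, IsTransposeOf ipH (adTH X) (fun Z => ⁅X, Z⁆))
    (hbT : ∀ X, IsTransposeOf ipH (bT X) (b X))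
    (hh : ∀ X Y₁ Y₂, ipH (b X Y₁) Y₂ = ipG (h Y₁ Y₂) X) (u : 𝔰) :
    IsTransposeOf ipS (fun v => e.symm (adTG (e u).1 (e v).1 - h (e u).2 (e v).2,
      adTH (e u).2 (e v).2 + bT (e u).1 (e v).2)) (fun v => ⁅u, v⁆) := by
  intro v w
  simp [hS, hbr, hTG _ _ _, hTH _ _ _, hbT _ _ _, ← hh]
  rw [hH.symm (b _ _)]
  ring

theorem semidirectCurvatureFormulas
    (hS : ∀ u v, ipS u v = ipG (e u).1 (e v).1 + ipH (e u).2 (e v).2)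
    (hbr : ∀ u v : 𝔰, e ⁅u, v⁆ =
      (⁅(e u).1, (e v).1⁆, ⁅(e u).2, (e v).2⁆ + b (e u).1 (e v).2 - b (e v).1 (e u).2))
    (hG : IsInnerProductForm ipG) (hH : IsInnerProductForm ipH) (hSS : IsInnerProductForm ipS)
    (hTG : ∀ X, IsTransposeOf ipG (adTG X) (fun Z => ⁅X, Z⁆))
    (hTH : ∀ X, IsTransposeOf ipH (adTH X) (fun Z => ⁅X, Z⁆))
    (hTS : ∀ X, IsTransposeOf ipS (adTS X) (fun Z => ⁅X, Z⁆))
    (hbT : ∀ X, IsTransposeOf ipH (bT X) (b X))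
    (hh : ∀ X Y₁ Y₂, ipH (b X Y₁) Y₂ = ipG (h Y₁ Y₂) X) :
    SemidirectCurvatureFormulas ipG (algCurvature adTG) ipH (algCurvature adTH)
      ipS (algCurvature adTS) (fun X Y => e.symm (X, Y)) adTG b bT h := by
  -- Transposes are unique, so a given `adTS` is the explicit one.
  have hT u v : adTS u v = e.symm (adTG (e u).1 (e v).1 - h (e u).2 (e v).2,
      adTH (e u).2 (e v).2 + bT (e u).1 (e v).2) := by
    refine hSS.ext_left fun w => ?_
    rw [hTS _ _, ← isTransposeOf_semidirect hS hbr hH hTG hTH hbT hh u]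
  have eb (u v : 𝔰) : ⁅u, v⁆ = e.symm (⁅(e u).1, (e v).1⁆,
      ⁅(e u).2, (e v).2⁆ + b (e u).1 (e v).2 - b (e v).1 (e u).2) := by
    rw [← hbr, e.symm_apply_apply]
  -- `b` and the transposes are bare functions; their vanishing at zero is recovered from the
  -- pairings.
  have hb0 (Y : 𝔥) : b 0 Y = 0 := hH.ext_left fun w => by simp [hh]
  have hb0' (X : 𝔤) : b X 0 = 0 := hH.ext_left fun w => by simp [hh]
  have hbT0 (Y : 𝔥) : bT 0 Y = 0 := hH.ext_left fun w => by simp [hbT _ _ _, hb0]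
  have hbT0' (X : 𝔤) : bT X 0 = 0 := hH.ext_left fun w => by simp [hbT _ _ _]
  have hTG0 (X : 𝔤) : adTG 0 X = 0 := hG.ext_left fun w => by simp [hTG _ _ _]
  have hTG0' (X : 𝔤) : adTG X 0 = 0 := hG.ext_left fun w => by simp [hTG _ _ _]
  have hTH0 (X : 𝔥) : adTH 0 X = 0 := hH.ext_left fun w => by simp [hTH _ _ _]
  have hTH0' (X : 𝔥) : adTH X 0 = 0 := hH.ext_left fun w => by simp [hTH _ _ _]
  have nabla (X₁ X₂ : 𝔤) (Y₁ Y₂ : 𝔥) :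
      algNabla adTS (e.symm (X₁, Y₁)) (e.symm (X₂, Y₂)) =
        e.symm (algNabla adTG X₁ X₂ - (2⁻¹ : ℝ) • (h Y₁ Y₂ + h Y₂ Y₁),
          algNabla adTH Y₁ Y₂ + (2⁻¹ : ℝ) • (bT X₁ Y₂ - b X₁ Y₂) +
            (2⁻¹ : ℝ) • (bT X₂ Y₁ + b X₂ Y₁)) := by
    simp only [algNabla, hT, eb, LinearEquiv.apply_symm_apply, ← map_add, ← map_sub, ← map_smul]
    congr 1
    ext <;> simp <;> module
  have nG0 (X : 𝔤) : algNabla adTG 0 X = 0 := by simp [algNabla, hTG0, hTG0']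
  have nG0' (X : 𝔤) : algNabla adTG X 0 = 0 := by simp [algNabla, hTG0, hTG0']
  have nH0 (Y : 𝔥) : algNabla adTH 0 Y = 0 := by simp [algNabla, hTH0, hTH0']
  have nH0' (Y : 𝔥) : algNabla adTH Y 0 = 0 := by simp [algNabla, hTH0, hTH0']
  have base (X₁ X₂ : 𝔤) :
      curvatureForm ipS (algCurvature adTS) (e.symm (X₁, 0)) (e.symm (X₂, 0)) =
        curvatureForm ipG (algCurvature adTG) X₁ X₂ := by
    simp [curvatureForm, algCurvature, nabla, eb, hS, hb0', hbT0', nH0']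
  have mixed (X : 𝔤) (Y : 𝔥) :
      curvatureForm ipS (algCurvature adTS) (e.symm (X, 0)) (e.symm (0, Y)) =
        ipG (h Y Y) (adTG X X) - (1 / 4) * ipH (b X Y + bT X Y) (b X Y + bT X Y)
        + (1 / 2) * ipH (bT X Y) (bT X Y) - (1 / 2) * ipH (b X Y) (b X Y) := by
    -- The terms `⟨h(·, ·), X⟩` of the expansion become inner products of `b(X)Y` and `b(X)ᵀY`.
    have h1 := hh X Y (bT X Y)
    have h2 := hh X Y (b X Y)
    have h3 := hh X (bT X Y) Y
    have h4 := hh X (b X Y) Y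
    rw [hH.symm _ Y, ← hbT X Y] at h3 h4
    have s1 := hH.symm (b X Y) (bT X Y)
    -- Metricity moves `∇_X` from `h(Y, Y)` to `X`, and `∇_X X = ad(X)ᵀX`: this is the first term of
    -- the formula.
    have h5 := algNabla_metric hG hTG X (h Y Y) X
    have h6 : algNabla adTG X X = adTG X X := by simp [algNabla, ← two_smul ℝ]
    rw [h6] at h5
    have h7 : algNabla adTG X (-(2⁻¹ : ℝ) • (h Y Y + h Y Y)) = -algNabla adTG X (h Y Y) := by
      rw [algNabla_smul_right hG hTG, algNabla_add_right hG hTG]; module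
    rw [neg_smul] at h7
    simp only [curvatureForm, algCurvature, nabla, eb, hS, hb0', hbT0', hbT0, hb0, nG0', nH0, h7, LinearEquiv.apply_symm_apply, map_zero, map_add, map_sub, map_smul, map_neg, zero_sub,
      sub_zero, add_zero, zero_add, smul_zero, LinearMap.zero_apply,
      LinearMap.add_apply, LinearMap.sub_apply, LinearMap.smul_apply, LinearMap.neg_apply,
      smul_eq_mul, lie_zero, zero_lie, ← h1, ← h2, ← h3, ← h4]
    linarith
  have fiber (Y₁ Y₂ : 𝔥) :
      curvatureForm ipS (algCurvature adTS) (e.symm (0, Y₁)) (e.symm (0, Y₂)) =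
        curvatureForm ipH (algCurvature adTH) Y₁ Y₂
        + (1 / 4) * ipG (h Y₁ Y₂ + h Y₂ Y₁) (h Y₁ Y₂ + h Y₂ Y₁)
        - ipG (h Y₁ Y₁) (h Y₂ Y₂) := by
    have hbT' (Z : 𝔤) (u v : 𝔥) : ipH (bT Z u) v = ipG (h v u) Z := by
      rw [hbT Z u v, hH.symm, hh]
    have s1 := hG.symm (h Y₁ Y₂) (h Y₂ Y₁)
    simp only [curvatureForm, algCurvature, nabla, eb, hS, hbT0, hb0, nG0', nG0,
      LinearEquiv.apply_symm_apply, map_zero, map_add, map_sub, map_smul, map_neg, zero_sub,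
      sub_zero, add_zero, zero_add, smul_zero,
      LinearMap.add_apply, LinearMap.sub_apply, LinearMap.smul_apply,
      smul_eq_mul, lie_zero, hh, hbT', sub_self]
    linarith
  exact
  { base := base
    base_sign := fun X₁ X₂ hli => by rw [hSS.sign_sectionalCurvature _ hli, base]
    mixed := mixed
    mixed_sign := fun X Y hli => by rw [hSS.sign_sectionalCurvature _ hli, mixed]
    fiber := fiber
    fiber_sign := fun Y₁ Y₂ hli => by rw [hSS.sign_sectionalCurvature _ hli, fiber] }

end Semidirect

/-! ### Cartan's formula and related vector fields -/

section Cartan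

variable {E : Type*} [NormedAddCommGroup E] [NormedSpace ℝ E]
  {HM : Type*} [TopologicalSpace HM] {I : ModelWithCorners ℝ E HM}
  {M : Type*} [TopologicalSpace M] [ChartedSpace HM M]
  {F : Type*} [NormedAddCommGroup F] [NormedSpace ℝ F]

variable (I) in
/-- The expression of the `F`-valued one-form `θ` in the extended chart at `p`. -/
noncomputable def formInChart (θ : ∀ x : M, TangentSpace I x →L[ℝ] F) (p : M) (e : E) : E →L[ℝ] F :=
  (θ ((extChartAt I p).symm e)).comp
    (mfderivWithin 𝓘(ℝ, E) I (extChartAt I p).symm (range I) e)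

variable (I) in
/-- The expression of the vector field `Y` in the extended chart at `p`. -/
noncomputable def fieldInChart (Y : ∀ x : M, TangentSpace I x) (p : M) (e : E) : E :=
  VectorField.mpullbackWithin 𝓘(ℝ, E) I (extChartAt I p).symm Y (range I) e

variable [IsManifold I 2 M]

theorem formInChart_self (θ : ∀ x : M, TangentSpace I x →L[ℝ] F) (p : M) (v : E) :
    formInChart I θ p (extChartAt I p p) v = θ p v := by
  have : IsManifold I 1 M := IsManifold.of_le (n := 2) (by norm_num)
  -- All tangent spaces are `E` by definition, so values at `p` and at its image under the chart and
  -- back are compared by substituting the point.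
  have h (x : M) (hx : x = p) : θ x (mfderivWithin 𝓘(ℝ, E) I (extChartAt I p).symm (range I)
      (extChartAt I p p) v) = θ p v := by
    subst hx
    exact congrArg (θ x) (DFunLike.congr_fun (mfderivWithin_range_extChartAt_symm (I := I)) v)
  exact h _ (extChartAt_to_inv p)

theorem fieldInChart_self (Y : ∀ x : M, TangentSpace I x) (p : M) :
    fieldInChart I Y p (extChartAt I p p) = Y p := by
  have : IsManifold I 1 M := IsManifold.of_le (n := 2) (by norm_num)
  have h (x : M) (hx : x = p) : (mfderivWithin 𝓘(ℝ, E) I (extChartAt I p).symm (range I)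
      (extChartAt I p p)).inverse (Y x) = (Y p : E) := by
    subst hx
    exact mfderivWithin_extChartAt_symm_inverse_apply _
  exact h _ (extChartAt_to_inv p)

theorem formInChart_fieldInChart (θ : ∀ x : M, TangentSpace I x →L[ℝ] F)
    (Y : ∀ x : M, TangentSpace I x) {p x : M} (hx : x ∈ (extChartAt I p).source) :
    formInChart I θ p (extChartAt I p x) (fieldInChart I Y p (extChartAt I p x)) = θ x (Y x) := by
  have : IsManifold I 1 M := IsManifold.of_le (n := 2) (by norm_num)
  have h (z : M) (hz : z = x) : θ z (mfderivWithin 𝓘(ℝ, E) I (extChartAt I p).symm (range I)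
      (extChartAt I p x) ((mfderivWithin 𝓘(ℝ, E) I (extChartAt I p).symm (range I)
      (extChartAt I p x)).inverse (Y z))) = θ x (Y x) := by
    subst hz
    have h := isInvertible_mfderivWithin_extChartAt_symm ((extChartAt I p).map_source hx)
    rw [(extChartAt I p).left_inv hx] at h
    exact congrArg (θ z) (h.self_apply_inverse (Y z))
  exact h _ ((extChartAt I p).left_inv hx)

theorem mlieBracket_eq_fieldInChart [I.Boundaryless] (X Y : ∀ x : M, TangentSpace I x) (p : M) :
    VectorField.mlieBracket I X Y p =
      fderiv ℝ (fieldInChart I Y p) (extChartAt I p p) (X p) -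
        fderiv ℝ (fieldInChart I X p) (extChartAt I p p) (Y p) := by
  have : IsManifold I 1 M := IsManifold.of_le (n := 2) (by norm_num)
  -- The bracket computed in the chart is pulled back by the derivative of the chart at its own
  -- centre, which is the identity.
  have h (A : E →L[ℝ] E) (hA : A = ContinuousLinearMap.id ℝ E) (v : E) : A.inverse v = v := by
    rw [hA, ContinuousLinearMap.inverse_id]; rfl
  rw [← VectorField.mlieBracketWithin_univ, VectorField.mlieBracketWithin_apply]
  refine (h _ mfderiv_extChartAt_self _).trans ?_
  change VectorField.lieBracketWithin ℝ (fieldInChart I X p) (fieldInChart I Y p) _ _ = _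
  rw [preimage_univ, univ_inter, I.range_eq_univ, VectorField.lieBracketWithin_univ,
    VectorField.lieBracket, fieldInChart_self, fieldInChart_self]

variable [I.Boundaryless] [CompleteSpace E]

theorem differentiableAt_fieldInChart {Y : ∀ x : M, TangentSpace I x} {p : M}
    (hY : MDiffAt (T% Y) p) : DifferentiableAt ℝ (fieldInChart I Y p) (extChartAt I p p) := by
  have h := MDifferentiableWithinAt.differentiableWithinAt_mpullbackWithin_vectorField
    (s := univ) (mdifferentiableWithinAt_univ.2 hY)
  rw [preimage_univ, univ_inter] at h
  exact h.differentiableAt (by rw [I.range_eq_univ]; exact univ_mem)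

theorem hasMFDerivAt_form_apply {θ : ∀ x : M, TangentSpace I x →L[ℝ] F} {p : M}
    (hθ : DifferentiableAt ℝ (formInChart I θ p) (extChartAt I p p))
    {Y : ∀ x : M, TangentSpace I x} (hY : MDiffAt (T% Y) p) :
    HasMFDerivAt I 𝓘(ℝ, F) (fun x => θ x (Y x)) p
      ((formInChart I θ p (extChartAt I p p)).comp
        (fderiv ℝ (fieldInChart I Y p) (extChartAt I p p)) +
      (fderiv ℝ (formInChart I θ p) (extChartAt I p p)).flip
        (fieldInChart I Y p (extChartAt I p p))) := by
  have : IsManifold I 1 M := IsManifold.of_le (n := 2) (by norm_num)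
  have h1 := hθ.hasFDerivAt.clm_apply (differentiableAt_fieldInChart hY).hasFDerivAt
  have h2 := h1.hasMFDerivAt.comp p
    (mdifferentiableAt_extChartAt (I := I) (mem_chart_source HM p)).hasMFDerivAt
  rw [mfderiv_extChartAt_self] at h2
  have h3 : (fun x => θ x (Y x)) =ᶠ[𝓝 p] (fun e => formInChart I θ p e (fieldInChart I Y p e)) ∘
      extChartAt I p := by
    filter_upwards [extChartAt_source_mem_nhds (I := I) p] with x hx
    exact (formInChart_fieldInChart θ Y hx).symm
  exact h2.congr_of_eventuallyEq h3

theorem mvfderiv_form_apply {θ : ∀ x : M, TangentSpace I x →L[ℝ] F} {p : M}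
    (hθ : DifferentiableAt ℝ (formInChart I θ p) (extChartAt I p p))
    {Y : ∀ x : M, TangentSpace I x} (hY : MDiffAt (T% Y) p) (v : TangentSpace I p) :
    mvfderiv I (fun x => θ x (Y x)) p v =
      θ p (fderiv ℝ (fieldInChart I Y p) (extChartAt I p p) v) +
      fderiv ℝ (formInChart I θ p) (extChartAt I p p) v (Y p) := by
  refine (DFunLike.congr_fun (hasMFDerivAt_form_apply hθ hY).mfderiv v).trans ?_
  refine congrArg₂ (fun a b : F => a + b) (formInChart_self θ p _) ?_
  exact congrArg (fderiv ℝ (formInChart I θ p) (extChartAt I p p) v) (fieldInChart_self Y p)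

/-- Cartan's formula: the exterior derivative of a one-form is tensorial. -/
theorem mvfderiv_form_sub {θ : ∀ x : M, TangentSpace I x →L[ℝ] F} {p : M}
    (hθ : DifferentiableAt ℝ (formInChart I θ p) (extChartAt I p p))
    {X Y : ∀ x : M, TangentSpace I x} (hX : MDiffAt (T% X) p) (hY : MDiffAt (T% Y) p) :
    mvfderiv I (fun x => θ x (Y x)) p (X p) - mvfderiv I (fun x => θ x (X x)) p (Y p)
      - θ p (VectorField.mlieBracket I X Y p) =
    fderiv ℝ (formInChart I θ p) (extChartAt I p p) (X p) (Y p) -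
      fderiv ℝ (formInChart I θ p) (extChartAt I p p) (Y p) (X p) := by
  -- The bracket term cancels exactly the derivatives of the fields; only the derivative of the form
  -- remains.
  have h : θ p (VectorField.mlieBracket I X Y p) =
      θ p (fderiv ℝ (fieldInChart I Y p) (extChartAt I p p) (X p)) -
        θ p (fderiv ℝ (fieldInChart I X p) (extChartAt I p p) (Y p)) :=
    (congrArg (θ p) (mlieBracket_eq_fieldInChart X Y p)).trans ((θ p).map_sub _ _)
  rw [h, mvfderiv_form_apply hθ hX, mvfderiv_form_apply hθ hY]
  abel

omit [IsManifold I 2 M] [CompleteSpace E] in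
theorem contDiffAt_comp_extChartAt_symm {a : M → F} {p : M} {n : ℕ∞ω}
    (ha : ContMDiffAt I 𝓘(ℝ, F) n a p) :
    ContDiffAt ℝ n (a ∘ (extChartAt I p).symm) (extChartAt I p p) := by
  have := (contMDiffAt_iff.1 ha).2
  rw [I.range_eq_univ, contDiffWithinAt_univ] at this
  exact this

omit [CompleteSpace E] in
-- By the chain rule the differential of `a` reads in the chart as the derivative of the chart
-- expression of `a`; class `C²` makes it differentiable.
theorem formInChart_mvfderiv {a : M → F} {p : M} (ha : ContMDiffAt I 𝓘(ℝ, F) 2 a p) :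
    DifferentiableAt ℝ (formInChart I (mvfderiv I a) p) (extChartAt I p p) ∧
      formInChart I (mvfderiv I a) p =ᶠ[𝓝 (extChartAt I p p)]
        fderiv ℝ (a ∘ (extChartAt I p).symm) := by
  have : IsManifold I 1 M := IsManifold.of_le (n := 2) (by norm_num)
  have hc := contDiffAt_comp_extChartAt_symm ha
  have hev : formInChart I (mvfderiv I a) p =ᶠ[𝓝 (extChartAt I p p)]
      fderiv ℝ (a ∘ (extChartAt I p).symm) := by
    have h1 : ∀ᶠ x in 𝓝 p, MDifferentiableAt I 𝓘(ℝ, F) a x :=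
      (contMDiffAt_iff_contMDiffAt_nhds (by simp)).1 ha |>.mono fun x hx => hx.mdifferentiableAt (by simp)
    have h2 : ∀ᶠ e in 𝓝 (extChartAt I p p), MDifferentiableAt I 𝓘(ℝ, F) a
        ((extChartAt I p).symm e) :=
      (continuousAt_extChartAt_symm (I := I) p).eventually (by rwa [extChartAt_to_inv])
    filter_upwards [h2, (extChartAt_target_mem_nhds (I := I) p)] with e he he'
    have h3 := mdifferentiableWithinAt_extChartAt_symm (I := I) he'
    have hu : UniqueMDiffWithinAt 𝓘(ℝ, E) (range I) e := by
      rw [I.range_eq_univ]; exact uniqueMDiffWithinAt_univ _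
    have h4 : mfderivWithin 𝓘(ℝ, E) 𝓘(ℝ, F) (a ∘ (extChartAt I p).symm) (range I) e =
        formInChart I (mvfderiv I a) p e := mfderiv_comp_mfderivWithin e he h3 hu
    rw [← h4, I.range_eq_univ, mfderivWithin_univ, mfderiv_eq_fderiv]

  refine ⟨?_, hev⟩
  exact ((hc.fderiv_right (m := 1) (by norm_num)).differentiableAt (by simp)).congr_of_eventuallyEq hev

/-- Second derivatives of functions are symmetric: differentials are closed. -/
theorem mvfderiv_mvfderiv_sub {a : M → F} {p : M} (ha : ContMDiffAt I 𝓘(ℝ, F) 2 a p)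
    {X Y : ∀ x : M, TangentSpace I x} (hX : MDiffAt (T% X) p) (hY : MDiffAt (T% Y) p) :
    mvfderiv I a p (VectorField.mlieBracket I X Y p) =
      mvfderiv I (fun x => mvfderiv I a x (Y x)) p (X p) -
      mvfderiv I (fun x => mvfderiv I a x (X x)) p (Y p) := by
  obtain ⟨hθ, hev⟩ := formInChart_mvfderiv ha
  have h5 := mvfderiv_form_sub hθ hX hY
  rw [hev.fderiv_eq] at h5
  have h6 : IsSymmSndFDerivAt ℝ (a ∘ (extChartAt I p).symm) (extChartAt I p p) :=
    (contDiffAt_comp_extChartAt_symm ha).isSymmSndFDerivAt (by simp)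
  rw [h6 (X p) (Y p), sub_self, sub_eq_zero] at h5
  exact h5.symm

variable {E' : Type*} [NormedAddCommGroup E'] [NormedSpace ℝ E'] [CompleteSpace E']
  {HN : Type*} [TopologicalSpace HN] {J : ModelWithCorners ℝ E' HN} [J.Boundaryless]
  {N : Type*} [TopologicalSpace N] [ChartedSpace HN N] [IsManifold J 2 N]

/-- The Lie bracket is compatible with fields related by a map. -/
theorem mfderiv_mlieBracket_of_related {f : M → N} {p : M} (hf : ContMDiffAt I J 2 f p)
    {X Y : ∀ x : M, TangentSpace I x} {X' Y' : ∀ x : N, TangentSpace J x}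
    (hX : MDiffAt (T% X) p) (hY : MDiffAt (T% Y) p)
    (hX' : MDiffAt (T% X') (f p)) (hY' : MDiffAt (T% Y') (f p))
    (hXX' : ∀ᶠ x in 𝓝 p, mfderiv I J f x (X x) = X' (f x))
    (hYY' : ∀ᶠ x in 𝓝 p, mfderiv I J f x (Y x) = Y' (f x)) :
    mfderiv I J f p (VectorField.mlieBracket I X Y p) = VectorField.mlieBracket J X' Y' (f p) := by
  have : IsManifold I 1 M := IsManifold.of_le (n := 2) (by norm_num)
  have : IsManifold J 1 N := IsManifold.of_le (n := 2) (by norm_num)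
  -- The chart has identity derivative at `f p`, so a vector there is determined by `dψ`. Closedness
  -- of `d(ψ ∘ f)` and of `dψ` then gives the claim without any invertibility of `f`.
  obtain ⟨ψ, hψ⟩ : ∃ ψ : N → E', ψ = extChartAt J (f p) := ⟨_, rfl⟩
  have hψ2 : ContMDiffAt J 𝓘(ℝ, E') 2 ψ (f p) := by rw [hψ]; exact contMDiffAt_extChartAt
  have ha : ContMDiffAt I 𝓘(ℝ, E') 2 (ψ ∘ f) p := hψ2.comp p hf
  have hid (v : TangentSpace J (f p)) : mvfderiv J ψ (f p) v = v := by
    rw [hψ]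
    exact DFunLike.congr_fun (mfderiv_extChartAt_self (I := J) (x := f p)) v
  have hfd : ∀ᶠ x in 𝓝 p, MDifferentiableAt I J f x :=
    (contMDiffAt_iff_contMDiffAt_nhds (by simp)).1 hf |>.mono fun x hx =>
      hx.mdifferentiableAt (by simp)
  have hψd : ∀ᶠ x in 𝓝 p, MDifferentiableAt J 𝓘(ℝ, E') ψ (f x) :=
    hf.continuousAt.eventually ((contMDiffAt_iff_contMDiffAt_nhds (by simp)).1 hψ2 |>.mono
      fun x hx => hx.mdifferentiableAt (by simp))
  have hchain : ∀ᶠ x in 𝓝 p, ∀ v : TangentSpace I x,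
      mvfderiv I (ψ ∘ f) x v = mvfderiv J ψ (f x) (mfderiv I J f x v) := by
    filter_upwards [hfd, hψd] with x h1 h2 v
    exact mfderiv_comp_apply x h2 h1 v
  have key {Z W : ∀ x : M, TangentSpace I x} {Z' W' : ∀ x : N, TangentSpace J x}
      (hZ' : MDiffAt (T% Z') (f p))
      (hZZ' : ∀ᶠ x in 𝓝 p, mfderiv I J f x (Z x) = Z' (f x))
      (hWW' : ∀ᶠ x in 𝓝 p, mfderiv I J f x (W x) = W' (f x)) :
      mvfderiv I (fun x => mvfderiv I (ψ ∘ f) x (Z x)) p (W p) =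
        mvfderiv J (fun x => mvfderiv J ψ x (Z' x)) (f p) (W' (f p)) := by
    have e1 : (fun x => mvfderiv I (ψ ∘ f) x (Z x)) =ᶠ[𝓝 p]
        (fun x => mvfderiv J ψ x (Z' x)) ∘ f := by
      filter_upwards [hchain, hZZ'] with x h1 h2
      rw [h1, h2]
      rfl
    have e2 : MDifferentiableAt J 𝓘(ℝ, E') (fun x => mvfderiv J ψ x (Z' x)) (f p) :=
      (hasMFDerivAt_form_apply (formInChart_mvfderiv hψ2).1 hZ').mdifferentiableAt
    have e3 := mfderiv_comp_apply p e2 hfd.self_of_nhds (W p)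
    rw [hWW'.self_of_nhds] at e3
    refine Eq.trans ?_ e3
    exact DFunLike.congr_fun e1.mfderiv_eq (W p)
  have h1 := mvfderiv_mvfderiv_sub ha hX hY
  have h2 := mvfderiv_mvfderiv_sub hψ2 hX' hY'
  rw [key hY' hYY' hXX', key hX' hXX' hYY', ← h2, hchain.self_of_nhds] at h1
  exact (hid _).symm.trans (h1.trans (hid _))

omit [CompleteSpace E] [CompleteSpace E'] [I.Boundaryless] [J.Boundaryless] in
theorem mdifferentiableAt_prod_field {X : ∀ x : M, TangentSpace I x}
    {Y : ∀ x : N, TangentSpace J x} {p : M × N} (hX : MDiffAt (T% X) p.1)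
    (hY : MDiffAt (T% Y) p.2) :
    MDifferentiableAt (I.prod J) (I.prod J).tangent
      (fun q : M × N => (⟨q, (X q.1, Y q.2)⟩ : TangentBundle (I.prod J) (M × N))) p := by
  have : IsManifold I 1 M := IsManifold.of_le (n := 2) (by norm_num)
  have : IsManifold J 1 N := IsManifold.of_le (n := 2) (by norm_num)
  have h1 : MDifferentiableAt (I.prod J) (I.tangent.prod J.tangent)
      (fun q : M × N => ((⟨q.1, X q.1⟩ : TangentBundle I M), (⟨q.2, Y q.2⟩ : TangentBundle J N))) p :=
    (hX.comp p mdifferentiableAt_fst).prodMk (hY.comp p mdifferentiableAt_snd)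
  exact ((contMDiff_equivTangentBundleProd_symm (n := 1)).mdifferentiable (by simp) _).comp p h1

/-- The projections relate the two fields to `X, 0` and to `0, Y`, so both components of the bracket
vanish. -/
theorem mlieBracket_prod_field_eq_zero {X : ∀ x : M, TangentSpace I x}
    {Y : ∀ x : N, TangentSpace J x} {p : M × N} (hX : MDiffAt (T% X) p.1)
    (hY : MDiffAt (T% Y) p.2) :
    VectorField.mlieBracket (I.prod J) (fun q : M × N => ((X q.1, 0) : E × E'))
      (fun q : M × N => ((0, Y q.2) : E × E')) p = (0 : E × E') := by
  have : IsManifold I 1 M := IsManifold.of_le (n := 2) (by norm_num)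
  have : IsManifold J 1 N := IsManifold.of_le (n := 2) (by norm_num)
  have z1 : MDiffAt (T% (fun x : M => (0 : TangentSpace I x))) p.1 :=
    Bundle.mdifferentiable_zeroSection ℝ (TangentSpace I : M → Type _) p.1
  have z2 : MDiffAt (T% (fun x : N => (0 : TangentSpace J x))) p.2 :=
    Bundle.mdifferentiable_zeroSection ℝ (TangentSpace J : N → Type _) p.2
  have h1 := mdifferentiableAt_prod_field (p := p) hX z2
  have h2 := mdifferentiableAt_prod_field (p := p) z1 hY
  have e1 := mfderiv_mlieBracket_of_related (f := Prod.fst) (p := p) contMDiffAt_fst h1 h2 hX z1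
    (.of_forall fun x => by rw [mfderiv_fst]; rfl) (.of_forall fun x => by rw [mfderiv_fst]; rfl)
  have e2 := mfderiv_mlieBracket_of_related (f := Prod.snd) (p := p) contMDiffAt_snd h1 h2 z2 hY
    (.of_forall fun x => by rw [mfderiv_snd]; rfl) (.of_forall fun x => by rw [mfderiv_snd]; rfl)
  rw [mfderiv_fst] at e1
  rw [mfderiv_snd] at e2
  have f1 : VectorField.mlieBracket I X (fun x => (0 : TangentSpace I x)) p.1 = 0 :=
    congrFun VectorField.mlieBracket_zero_right p.1
  have f2 : VectorField.mlieBracket J (fun x => (0 : TangentSpace J x)) Y p.2 = 0 :=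
    congrFun VectorField.mlieBracket_zero_left p.2
  exact Prod.ext (e1.trans f1) (e2.trans f2)

end Cartan

/-! ### The chain rule through a map of two variables -/

section Chain

variable {E₁ : Type*} [NormedAddCommGroup E₁] [NormedSpace ℝ E₁]
  {H₁ : Type*} [TopologicalSpace H₁] {I₁ : ModelWithCorners ℝ E₁ H₁}
  {M₁ : Type*} [TopologicalSpace M₁] [ChartedSpace H₁ M₁]
  {E₂ : Type*} [NormedAddCommGroup E₂] [NormedSpace ℝ E₂]
  {H₂ : Type*} [TopologicalSpace H₂] {I₂ : ModelWithCorners ℝ E₂ H₂}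
  {M₂ : Type*} [TopologicalSpace M₂] [ChartedSpace H₂ M₂]
  {E₃ : Type*} [NormedAddCommGroup E₃] [NormedSpace ℝ E₃]
  {H₃ : Type*} [TopologicalSpace H₃] {I₃ : ModelWithCorners ℝ E₃ H₃}
  {M₃ : Type*} [TopologicalSpace M₃] [ChartedSpace H₃ M₃]
  {E₄ : Type*} [NormedAddCommGroup E₄] [NormedSpace ℝ E₄]
  {H₄ : Type*} [TopologicalSpace H₄] {I₄ : ModelWithCorners ℝ E₄ H₄}
  {M₄ : Type*} [TopologicalSpace M₄] [ChartedSpace H₄ M₄]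

theorem mfderiv_comp₂_apply {m : M₂ × M₃ → M₄} {c₁ : M₁ → M₂} {c₂ : M₁ → M₃} {k : M₁}
    (hm : MDifferentiableAt (I₂.prod I₃) I₄ m (c₁ k, c₂ k)) (h₁ : MDifferentiableAt I₁ I₂ c₁ k)
    (h₂ : MDifferentiableAt I₁ I₃ c₂ k) (v : TangentSpace I₁ k) :
    mfderiv I₁ I₄ (fun x => m (c₁ x, c₂ x)) k v =
      mfderiv I₂ I₄ (fun z => m (z, c₂ k)) (c₁ k) (mfderiv I₁ I₂ c₁ k v) +
      mfderiv I₃ I₄ (fun z => m (c₁ k, z)) (c₂ k) (mfderiv I₁ I₃ c₂ k v) := by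
  have h1 := mfderiv_comp_apply k hm (h₁.prodMk h₂) v
  have h2 : mfderiv I₁ (I₂.prod I₃) (fun x => (c₁ x, c₂ x)) k v =
      ((mfderiv I₁ I₂ c₁ k v, mfderiv I₁ I₃ c₂ k v) : E₂ × E₃) :=
    DFunLike.congr_fun (h₁.mfderiv_prod h₂) v
  exact (h1.trans (congrArg _ h2)).trans (mfderiv_prod_eq_add_apply hm)

end Chain

/-! ### Right trivialization and inversion on a Lie group -/

section LieGroup

variable {E : Type*} [NormedAddCommGroup E] [NormedSpace ℝ E]
  {HM : Type*} [TopologicalSpace HM] {I : ModelWithCorners ℝ E HM}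
  {G : Type*} [TopologicalSpace G] [ChartedSpace HM G] [Group G]

/-- The right trivialization as a one-form with values in the model space. -/
noncomputable def rightForm (x : G) : TangentSpace I x →L[ℝ] E :=
  rightTriv x

theorem rightInvariantField_one (v : GroupLieAlgebra I G) :
    (rightInvariantField v 1 : E) = v := by
  have : (fun y : G => y * 1) = id := by ext; simp
  rw [rightInvariantField, this, mfderiv_id]
  rfl

theorem rightTriv_one (v : TangentSpace I (1 : G)) : (rightTriv (1 : G) v : E) = v := by
  have : (fun y : G => y * (1 : G)⁻¹) = id := by ext; simp
  rw [rightTriv, this, mfderiv_id]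
  rfl

theorem mulInvariantVectorField_one (v : GroupLieAlgebra I G) :
    (mulInvariantVectorField v (1 : G) : E) = v := by
  have : (fun y : G => 1 * y) = id := by ext; simp
  rw [mulInvariantVectorField, this, mfderiv_id]
  rfl

variable [LieGroup I ∞ G]

theorem lieGroup_minSmoothness_three : LieGroup I (minSmoothness ℝ 3) G := by
  rw [minSmoothness_of_isRCLikeNormedField]; infer_instance

attribute [local instance] lieGroup_minSmoothness_three

theorem rightTriv_rightInvariantField (x : G) (v : GroupLieAlgebra I G) :
    rightTriv x (rightInvariantField v x) = v := by
  have h1 := mfderiv_comp_apply_of_eq (x := (1 : G))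
    (mdifferentiableAt_mul_right (I := I) (a := x⁻¹) (b := x))
    (mdifferentiableAt_mul_right (I := I) (a := x) (b := 1)) (one_mul x) v
  have h2 : (fun y : G => y * x⁻¹) ∘ (fun y => y * x) = id := by ext; simp
  rw [h2, mfderiv_id] at h1
  exact h1.symm

theorem rightInvariantField_rightTriv (x : G) (v : TangentSpace I x) :
    rightInvariantField (rightTriv x v) x = v := by
  have h1 := mfderiv_comp_apply_of_eq (x := x)
    (mdifferentiableAt_mul_right (I := I) (a := x) (b := 1))
    (mdifferentiableAt_mul_right (I := I) (a := x⁻¹) (b := x)) (mul_inv_cancel x) v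
  have h2 : (fun y : G => y * x) ∘ (fun y => y * x⁻¹) = id := by ext; simp
  rw [h2, mfderiv_id] at h1
  exact h1.symm

theorem mdifferentiableAt_inv (x : G) : MDifferentiableAt I I (fun x : G => x⁻¹) x :=
  (contMDiff_inv I ∞).mdifferentiable (by simp) x

theorem mdifferentiableAt_mul (p : G × G) :
    MDifferentiableAt (I.prod I) I (fun p : G × G => p.1 * p.2) p :=
  (contMDiff_mul I ∞).mdifferentiable (by simp) p

/-- Differentiate `x * x⁻¹ = 1` at the identity. -/
theorem mfderiv_inv_one (v : GroupLieAlgebra I G) :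
    (mfderiv I I (fun x : G => x⁻¹) 1 v : E) = -v := by
  have h1 := mfderiv_comp₂_apply (m := fun p : G × G => p.1 * p.2) (c₁ := id) (c₂ := fun x => x⁻¹)
    (k := 1) (mdifferentiableAt_mul (I := I) _) mdifferentiableAt_id (mdifferentiableAt_inv 1) v
  have h2 : (fun x : G => id x * x⁻¹) = fun _ => 1 := by ext; simp
  have h3 : (fun x : G => x * (1 : G)⁻¹) = id := by ext; simp
  have h4 : (fun x : G => id 1 * x) = id := by ext; simp
  dsimp only at h1
  rw [h2, h3, h4, mfderiv_const] at h1
  simp only [mfderiv_id] at h1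
  exact (neg_eq_of_add_eq_zero_right h1.symm).symm

theorem mfderiv_inv_mfderiv_inv {x y : G} (h : x⁻¹ = y) (w : E) :
    (mfderiv I I (fun x : G => x⁻¹) y (mfderiv I I (fun x : G => x⁻¹) x w) : E) = w := by
  subst h
  have h1 := mfderiv_comp_apply (x := x) (mdifferentiableAt_inv (I := I) x⁻¹)
    (mdifferentiableAt_inv x) w
  have h2 : (fun x : G => x⁻¹) ∘ (fun x : G => x⁻¹) = id := by ext; simp
  rw [h2, mfderiv_id] at h1
  exact h1.symm

theorem isInvertible_mfderiv_inv (x : G) : (mfderiv I I (fun x : G => x⁻¹) x).IsInvertible :=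
  ContinuousLinearMap.IsInvertible.of_inverse
    (f := (mfderiv I I (fun x : G => x⁻¹) x : E →L[ℝ] E))
    (g := (mfderiv I I (fun x : G => x⁻¹) x⁻¹ : E →L[ℝ] E))
    (ContinuousLinearMap.ext fun w => mfderiv_inv_mfderiv_inv (E := E) (inv_inv x) w)
    (ContinuousLinearMap.ext fun w => mfderiv_inv_mfderiv_inv (E := E) rfl w)

/-- Inversion exchanges left and right translations and is `-1` on the Lie algebra. Regularity and
brackets of right invariant fields are thereby inherited from the left invariant ones. -/
theorem mpullback_inv_mulInvariantVectorField (v : GroupLieAlgebra I G) :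
    VectorField.mpullback I I (fun x : G => x⁻¹) (mulInvariantVectorField (-v)) =
      rightInvariantField v := by
  funext x
  have h1 : (mfderiv I I (fun x : G => x⁻¹) x).inverse =
      (mfderiv I I (fun x : G => x⁻¹) x⁻¹ : E →L[ℝ] E) :=
    ContinuousLinearMap.inverse_eq (f := (mfderiv I I (fun x : G => x⁻¹) x : E →L[ℝ] E))
      (ContinuousLinearMap.ext fun w => mfderiv_inv_mfderiv_inv (E := E) (inv_inv x) w)
      (ContinuousLinearMap.ext fun w => mfderiv_inv_mfderiv_inv (E := E) rfl w)
  have h2 : VectorField.mpullback I I (fun x : G => x⁻¹) (mulInvariantVectorField (-v)) x =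
      mfderiv I I (fun x : G => x⁻¹) x⁻¹ (mulInvariantVectorField (-v) x⁻¹) :=
    DFunLike.congr_fun h1 _
  rw [h2]
  have h3 := mfderiv_comp_apply_of_eq (x := (1 : G)) (mdifferentiableAt_inv (I := I) x⁻¹)
    (mdifferentiableAt_mul_left (I := I) (a := x⁻¹) (b := 1)) (mul_one _) (-v)
  have h4 := mfderiv_comp_apply_of_eq (x := (1 : G))
    (mdifferentiableAt_mul_right (I := I) (a := x) (b := 1)) (mdifferentiableAt_inv 1)
    inv_one (-v)
  have h5 : (fun x : G => x⁻¹) ∘ (fun y => x⁻¹ * y) = (fun y => y * x) ∘ (fun x => x⁻¹) := by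
    ext; simp
  rw [h5] at h3
  refine (h3.symm.trans h4).trans ?_
  have h6 : (mfderiv I I (fun x : G => x⁻¹) 1 (-v) : E) = v := by
    rw [mfderiv_inv_one, neg_neg]
  exact congrArg (mfderiv I I (fun y : G => y * x) 1) h6

/-- The form is a partial derivative of the smooth map `(x, y) ↦ y * x⁻¹` taken on the diagonal. The
target point is always `1`, so the target coordinates are trivial and `inTangentCoordinates` agrees
with the chart expression. -/
theorem differentiableAt_formInChart_rightForm [I.Boundaryless] (p : G) :
    DifferentiableAt ℝ (formInChart I (rightForm (I := I) (G := G)) p)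
      (extChartAt I p p) := by
  have h1 : ContMDiffAt (I.prod I) I 2 (Function.uncurry fun x y : G => y * x⁻¹) (p, p) :=
    contMDiffAt_snd.mul contMDiffAt_fst.inv
  have h2 := (ContMDiffAt.mfderiv (x₀ := p) (m := 1) (fun x y : G => y * x⁻¹) id h1
    contMDiffAt_id (by norm_num)).mdifferentiableAt (by simp)
  have h3 : (fun x : G => x * x⁻¹) = fun _ => 1 := by ext; simp
  dsimp only [id] at h2
  rw [h3] at h2
  have h4 : DifferentiableAt ℝ ((inTangentCoordinates I I id (fun _ => (1 : G))
      (fun x => mfderiv I I (fun y : G => y * x⁻¹) x) p) ∘ (extChartAt I p).symm)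
      (extChartAt I p p) := by
    have h5 : MDifferentiableAt 𝓘(ℝ, E) I (extChartAt I p).symm (extChartAt I p p) := by
      have := mdifferentiableWithinAt_extChartAt_symm (I := I) (mem_extChartAt_target p)
      rwa [I.range_eq_univ, mdifferentiableWithinAt_univ] at this
    exact (MDifferentiableAt.comp_of_eq _ h2 h5 (extChartAt_to_inv p)).differentiableAt
  refine h4.congr_of_eventuallyEq ?_
  filter_upwards [extChartAt_target_mem_nhds (I := I) p] with e he
  have hs : (extChartAt I p).symm e ∈ (chartAt HM p).source := by
    rw [← extChartAt_source I]
    exact (extChartAt I p).map_target he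
  have h6 := inTangentCoordinates_eq_mfderiv_comp (I := I) (I' := I) (f := id)
    (g := fun _ => (1 : G)) (ϕ := fun x => (mfderiv I I (fun y : G => y * x⁻¹) x : E →L[ℝ] E))
    (x₀ := p) (x := (extChartAt I p).symm e) hs (mem_chart_source _ _)
  refine Eq.trans ?_ h6.symm
  rw [mfderiv_extChartAt_self]
  have h7 (A B : E →L[ℝ] E) (h : A = B) (w : E) : (rightTriv (I := I) ((extChartAt I p).symm e) (A w) : E) =
      rightTriv (I := I) ((extChartAt I p).symm e) (B w) := by rw [h]
  exact ContinuousLinearMap.ext fun w => h7 _ _ (congrArg (fun e' =>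
    (mfderivWithin 𝓘(ℝ, E) I (extChartAt I p).symm (range I) e' : E →L[ℝ] E))
    ((extChartAt I p).right_inv he).symm) w

end LieGroup

/-! ### Maurer-Cartan equation, adjoint action and homomorphisms -/

section LieGroup

attribute [local instance] lieGroup_minSmoothness_three

variable {E : Type*} [NormedAddCommGroup E] [NormedSpace ℝ E] [CompleteSpace E]
  {HM : Type*} [TopologicalSpace HM] {I : ModelWithCorners ℝ E HM} [I.Boundaryless]
  {G : Type*} [TopologicalSpace G] [ChartedSpace HM G] [Group G] [LieGroup I ∞ G]

omit [I.Boundaryless] in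
theorem mdifferentiableAt_rightInvariantField (v : GroupLieAlgebra I G) (x : G) :
    MDiffAt (T% (rightInvariantField v : ∀ x : G, TangentSpace I x)) x := by
  rw [← mpullback_inv_mulInvariantVectorField]
  refine MDifferentiableAt.mpullback_vectorField (n := ∞)
    (mdifferentiableAt_mulInvariantVectorField (-v)) (contMDiff_inv I ∞ x)
    (isInvertible_mfderiv_inv x) (by norm_cast)

omit [I.Boundaryless] in
-- The fields are pullbacks under inversion of the left invariant fields of `-u` and `-v`, whose
-- bracket is that of `⁅u, v⁆`; pulling back once more produces the sign.
theorem mlieBracket_rightInvariantField (u v : GroupLieAlgebra I G) :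
    VectorField.mlieBracket I (rightInvariantField u : ∀ x : G, TangentSpace I x)
      (rightInvariantField v) = rightInvariantField (-⁅u, v⁆) := by
  funext x
  rw [← mpullback_inv_mulInvariantVectorField u, ← mpullback_inv_mulInvariantVectorField v,
    ← mpullback_inv_mulInvariantVectorField (-⁅u, v⁆), neg_neg,
    ← VectorField.mpullback_mlieBracket (n := ∞) (mdifferentiableAt_mulInvariantVectorField _)
      (mdifferentiableAt_mulInvariantVectorField _) (contMDiff_inv I ∞ x)
      (by rw [minSmoothness_of_isRCLikeNormedField]; norm_cast),
    ← mulInvariantVector_mlieBracket, ← GroupLieAlgebra.bracket_def, neg_lie, lie_neg, neg_neg]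

omit [CompleteSpace E] [I.Boundaryless] in
theorem mvfderiv_rightForm_rightInvariantField (v : GroupLieAlgebra I G) (x : G)
    (w : TangentSpace I x) : mvfderiv I (fun z => rightForm z (rightInvariantField v z)) x w = 0 := by
  have h : (fun z : G => rightForm z (rightInvariantField v z)) = fun _ => (v : E) :=
    funext fun z => rightTriv_rightInvariantField z v
  rw [h]
  exact DFunLike.congr_fun (mvfderiv_const (F := E) v) w

/-- By tensoriality, right invariant extensions of `u` and `v` may be used. On these the form is
constant, and only the bracket term survives. -/
theorem fderiv_formInChart_rightForm_sub (x : G) (u v : TangentSpace I x) :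
    fderiv ℝ (formInChart I (rightForm (I := I) (G := G)) x) (extChartAt I x x) u v -
      fderiv ℝ (formInChart I (rightForm (I := I) (G := G)) x) (extChartAt I x x) v u =
    (⁅rightTriv x u, rightTriv x v⁆ : GroupLieAlgebra I G) := by
  have h := mvfderiv_form_sub (differentiableAt_formInChart_rightForm (I := I) x)
    (mdifferentiableAt_rightInvariantField (rightTriv x u) x)
    (mdifferentiableAt_rightInvariantField (rightTriv x v) x)
  simp only [rightInvariantField_rightTriv] at h
  rw [mvfderiv_rightForm_rightInvariantField, mvfderiv_rightForm_rightInvariantField,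
    mlieBracket_rightInvariantField, sub_self, zero_sub] at h
  refine h.symm.trans ((congrArg (fun z : E => -z)
    (rightTriv_rightInvariantField x (-⁅rightTriv x u, rightTriv x v⁆))).trans ?_)
  exact neg_neg (G := E) _

/-- The Maurer-Cartan equation of the right trivialization. -/
theorem rightForm_mlieBracket {X Y : ∀ x : G, TangentSpace I x} {x : G}
    (hX : MDiffAt (T% X) x) (hY : MDiffAt (T% Y) x) :
    mvfderiv I (fun z => rightForm z (Y z)) x (X x) -
      mvfderiv I (fun z => rightForm z (X z)) x (Y x) -
      rightForm x (VectorField.mlieBracket I X Y x) =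
    (⁅rightTriv x (X x), rightTriv x (Y x)⁆ : GroupLieAlgebra I G) :=
  (mvfderiv_form_sub (differentiableAt_formInChart_rightForm x) hX hY).trans
    (fderiv_formInChart_rightForm_sub x _ _)

theorem mdifferentiableAt_rightForm {Y : ∀ x : G, TangentSpace I x} {x : G}
    (hY : MDiffAt (T% Y) x) :
    MDifferentiableAt I 𝓘(ℝ, E) (fun z => rightForm z (Y z)) x :=
  (hasMFDerivAt_form_apply (differentiableAt_formInChart_rightForm x) hY).mdifferentiableAt

/-- At the identity the bracket is the antisymmetrization of the derivative of the chart expression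
of the form, a continuous bilinear map. -/
theorem continuous_lie_left (v : GroupLieAlgebra I G) :
    Continuous fun u : GroupLieAlgebra I G => ⁅u, v⁆ := by
  let T : E →L[ℝ] E →L[ℝ] E :=
    fderiv ℝ (formInChart I (rightForm (I := I) (G := G)) 1) (extChartAt I 1 (1 : G))
  have h (u : GroupLieAlgebra I G) : ⁅u, v⁆ = T u v - T v u := by
    have h := fderiv_formInChart_rightForm_sub (I := I) (1 : G) u v
    rw [show rightTriv (1 : G) u = u from rightTriv_one u,
      show rightTriv (1 : G) v = v from rightTriv_one v] at h
    exact h.symm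
  simp_rw [h]
  exact ((T.flip v).continuous.sub (T v).continuous : Continuous fun u : E => T u v - T v u)

/-- Multiplication `G × G → G` relates the commuting fields of the two factors to the right and the
left invariant field. -/
theorem mlieBracket_rightInvariantField_mulInvariantVectorField (u v : GroupLieAlgebra I G) :
    VectorField.mlieBracket I (rightInvariantField u : ∀ x : G, TangentSpace I x)
      (mulInvariantVectorField v) 1 = 0 := by
  have h1 := mdifferentiableAt_rightInvariantField u (1 : G)
  have h2 := mdifferentiableAt_mulInvariantVectorField v (g := (1 : G))
  have z : MDiffAt (T% (fun x : G => (0 : TangentSpace I x))) (1 : G) :=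
    Bundle.mdifferentiable_zeroSection ℝ (TangentSpace I : G → Type _) 1
  have hm (q : G × G) (a b : E) : mfderiv (I.prod I) I (fun p : G × G => p.1 * p.2) q (a, b) =
      (mfderiv I I (fun x : G => x * q.2) q.1 a + mfderiv I I (fun x : G => q.1 * x) q.2 b : E) :=
    mfderiv_prod_eq_add_apply (mdifferentiableAt_mul q)
  have h3 := mfderiv_mlieBracket_of_related (p := ((1, 1) : G × G))
    (f := fun p : G × G => p.1 * p.2) (J := I)
    (X' := rightInvariantField u) (Y' := mulInvariantVectorField v)
    ((contMDiff_mul I 2) _)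
    (mdifferentiableAt_prod_field (p := ((1, 1) : G × G)) h1 z)
    (mdifferentiableAt_prod_field (p := ((1, 1) : G × G)) z h2)
    (mdifferentiableAt_rightInvariantField u _) (mdifferentiableAt_mulInvariantVectorField v)
    (.of_forall fun q => ?_) (.of_forall fun q => ?_)
  · have h4 := mlieBracket_prod_field_eq_zero (p := ((1, 1) : G × G)) h1 h2
    have h5 : VectorField.mlieBracket I (rightInvariantField u : ∀ x : G, TangentSpace I x)
        (mulInvariantVectorField v) (1 * 1) = 0 :=
      h3.symm.trans ((congrArg _ h4).trans (ContinuousLinearMap.map_zero _))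
    rwa [mul_one] at h5
  · refine (hm q _ _).trans ?_
    have h4 := mfderiv_comp_apply_of_eq (x := (1 : G))
      (mdifferentiableAt_mul_right (I := I) (a := q.2) (b := q.1))
      (mdifferentiableAt_mul_right (I := I) (a := q.1) (b := 1)) (one_mul _) u
    have h5 : (fun x => x * q.2) ∘ (fun x => x * q.1) = fun x => x * (q.1 * q.2) := by
      ext; simp [mul_assoc]
    rw [h5] at h4
    refine Eq.trans ?_ h4.symm
    rw [ContinuousLinearMap.map_zero]
    exact add_zero _
  · refine (hm q _ _).trans ?_
    have h4 := mfderiv_comp_apply_of_eq (x := (1 : G))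
      (mdifferentiableAt_mul_left (I := I) (a := q.1) (b := q.2))
      (mdifferentiableAt_mul_left (I := I) (a := q.2) (b := 1)) (mul_one _) v
    have h5 : (fun x => q.1 * x) ∘ (fun x => q.2 * x) = fun x => (q.1 * q.2) * x := by
      ext; simp [mul_assoc]
    rw [h5] at h4
    refine Eq.trans ?_ h4.symm
    rw [ContinuousLinearMap.map_zero]
    exact zero_add _

/-- The derivative of the adjoint representation is the Lie bracket. -/
theorem mvfderiv_rightForm_mulInvariantVectorField (u v : GroupLieAlgebra I G) :
    mvfderiv I (fun x : G => rightForm x (mulInvariantVectorField v x)) 1 u =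
      (⁅u, v⁆ : GroupLieAlgebra I G) := by
  have h := rightForm_mlieBracket (mdifferentiableAt_rightInvariantField u (1 : G))
    (mdifferentiableAt_mulInvariantVectorField v)
  rw [mlieBracket_rightInvariantField_mulInvariantVectorField,
    mvfderiv_rightForm_rightInvariantField, ContinuousLinearMap.map_zero, sub_zero, sub_zero,
    rightTriv_rightInvariantField,
    show (rightInvariantField u : ∀ x : G, TangentSpace I x) 1 = u from rightInvariantField_one u,
    show (mulInvariantVectorField v (1 : G)) = v from mulInvariantVectorField_one v,
    show rightTriv (1 : G) v = v from rightTriv_one v] at h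
  exact h

variable {E' : Type*} [NormedAddCommGroup E'] [NormedSpace ℝ E'] [CompleteSpace E']
  {HN : Type*} [TopologicalSpace HN] {J : ModelWithCorners ℝ E' HN} [J.Boundaryless]
  {K : Type*} [TopologicalSpace K] [ChartedSpace HN K] [Group K] [LieGroup J ∞ K]

/-- The derivative of a group homomorphism is a homomorphism of Lie algebras. -/
theorem mfderiv_lie (f : G →* K) (hf : ContMDiff I J ∞ f) {u v : GroupLieAlgebra I G}
    {u' v' : GroupLieAlgebra J K} (hu : (mfderiv I J f 1 u : E') = u')
    (hv : (mfderiv I J f 1 v : E') = v') :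
    (mfderiv I J f 1 (⁅u, v⁆ : GroupLieAlgebra I G) : E') = (⁅u', v'⁆ : GroupLieAlgebra J K) := by
  have hd (x : G) : MDifferentiableAt I J f x := hf.mdifferentiable (by simp) x
  have hrel {w : GroupLieAlgebra I G} {w' : GroupLieAlgebra J K}
      (hw : (mfderiv I J f 1 w : E') = w') (x : G) :
      mfderiv I J f x (mulInvariantVectorField w x) = mulInvariantVectorField w' (f x) := by
    have h1 := mfderiv_comp_apply_of_eq (x := (1 : G)) (hd x)
      (mdifferentiableAt_mul_left (I := I) (a := x) (b := 1)) (mul_one x) w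
    have h2 := mfderiv_comp_apply_of_eq (x := (1 : G))
      (mdifferentiableAt_mul_left (I := J) (a := f x) (b := 1)) (hd 1) (map_one f) w
    have h3 : f ∘ (fun y => x * y) = (fun y => f x * y) ∘ f := by ext; simp
    rw [h3] at h1
    exact (h1.symm.trans h2).trans (congrArg (mfderiv J J (fun y => f x * y) 1) hw)
  have h := mfderiv_mlieBracket_of_related (p := (1 : G)) ((hf 1).of_le (by norm_cast))
    (mdifferentiableAt_mulInvariantVectorField u) (mdifferentiableAt_mulInvariantVectorField v)
    (mdifferentiableAt_mulInvariantVectorField u') (mdifferentiableAt_mulInvariantVectorField v')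
    (.of_forall (hrel hu)) (.of_forall (hrel hv))
  refine h.trans ?_
  rw [GroupLieAlgebra.bracket_def]
  have key (z : K) (hz : z = 1) : (VectorField.mlieBracket J (mulInvariantVectorField u')
      (mulInvariantVectorField v') z : E') = VectorField.mlieBracket J (mulInvariantVectorField u')
      (mulInvariantVectorField v') 1 := by subst hz; rfl
  exact key _ (map_one f)

end LieGroup

/-! ### Bounded bilinear forms -/

section Bilinear

variable {E : Type*} [NormedAddCommGroup E] [NormedSpace ℝ E]

/-- A jointly continuous bilinear form as a continuous bilinear map. -/
theorem exists_toContinuousBilinear (B : LinearMap.BilinForm ℝ E)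
    (hc : Continuous fun p : E × E => B p.1 p.2) :
    ∃ T : E →L[ℝ] E →L[ℝ] ℝ, ∀ u v, T u v = B u v := by
  obtain ⟨ε, hε, h⟩ := Metric.continuousAt_iff.1 (hc.continuousAt (x := ((0, 0) : E × E))) 1 one_pos
  -- Both vectors are rescaled to length `ε / 2`, where the form is less than `1` in absolute value.
  have hb (u v : E) : ‖B u v‖ ≤ (2 / ε) ^ 2 * ‖u‖ * ‖v‖ := by
    rcases eq_or_ne u 0 with rfl | hu
    · simp
    rcases eq_or_ne v 0 with rfl | hv
    · simp
    have hu' := norm_pos_iff.2 hu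
    have hv' := norm_pos_iff.2 hv
    have hs (w : E) (hw : 0 < ‖w‖) : ‖(ε / 2 / ‖w‖) • w‖ < ε := by
      rw [norm_smul, Real.norm_of_nonneg (by positivity), div_mul_cancel₀ _ hw.ne']
      linarith
    have h1 := @h ((ε / 2 / ‖u‖) • u, (ε / 2 / ‖v‖) • v) (by
      rw [dist_eq_norm, Prod.norm_def]
      simpa using And.intro (hs u hu') (hs v hv'))
    simp only [map_smul, map_zero, LinearMap.smul_apply, dist_zero_right, norm_smul] at h1
    rw [Real.norm_of_nonneg (by positivity), Real.norm_of_nonneg (by positivity)] at h1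
    have h2 : ‖B u v‖ = (2 / ε) ^ 2 * ‖u‖ * ‖v‖ * (ε / 2 / ‖v‖ * (ε / 2 / ‖u‖ * ‖B u v‖)) := by
      field_simp
    rw [h2]
    exact mul_le_of_le_one_right (by positivity) h1.le
  exact ⟨B.mkContinuous₂ _ hb, fun u v => rfl⟩

variable {HM : Type*} [TopologicalSpace HM] {I : ModelWithCorners ℝ E HM}
  {M : Type*} [TopologicalSpace M] [ChartedSpace HM M]
  {F : Type*} [NormedAddCommGroup F] [NormedSpace ℝ F]

theorem mvfderiv_bilinear (T : F →L[ℝ] F →L[ℝ] ℝ) {f g : M → F} {x : M}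
    (hf : MDifferentiableAt I 𝓘(ℝ, F) f x) (hg : MDifferentiableAt I 𝓘(ℝ, F) g x)
    (v : TangentSpace I x) :
    mvfderiv I (fun z => T (f z) (g z)) x v =
      T (mvfderiv I f x v) (g x) + T (f x) (mvfderiv I g x v) := by
  have hm : MDifferentiableAt (𝓘(ℝ, F).prod 𝓘(ℝ, F)) 𝓘(ℝ, ℝ) (fun p : F × F => T p.1 p.2)
      (f x, g x) := by
    rw [← modelWithCornersSelf_prod, chartedSpaceSelf_prod]
    exact (T.isBoundedBilinearMap.differentiableAt (f x, g x)).mdifferentiableAt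
  have h := mfderiv_comp₂_apply hm hf hg v
  have h1 : mfderiv 𝓘(ℝ, F) 𝓘(ℝ, ℝ) (fun z => T z (g x)) (f x) = T.flip (g x) :=
    (T.flip (g x)).mfderiv_eq
  have h2 : mfderiv 𝓘(ℝ, F) 𝓘(ℝ, ℝ) (fun z => T (f x) z) (g x) = T (f x) :=
    (T (f x)).mfderiv_eq
  dsimp only at h
  rw [h1, h2] at h
  exact h

end Bilinear

/-! ### Levi-Civita derivative of a right invariant metric -/

section LeviCivita

attribute [local instance] lieGroup_minSmoothness_three

variable {E : Type*} [NormedAddCommGroup E] [NormedSpace ℝ E] [CompleteSpace E]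
  {HM : Type*} [TopologicalSpace HM] {I : ModelWithCorners ℝ E HM} [I.Boundaryless]
  {G : Type*} [TopologicalSpace G] [ChartedSpace HM G] [Group G] [LieGroup I ∞ G]
  {B : LinearMap.BilinForm ℝ (GroupLieAlgebra I G)}
  {adT : GroupLieAlgebra I G → GroupLieAlgebra I G → GroupLieAlgebra I G}

omit [I.Boundaryless] in
-- On right invariant fields the metric is constant and the bracket is `-⁅u, v⁆`, so the two
-- Levi-Civita axioms at `x` become the hypotheses of `eq_algNabla`.
theorem cov_rightInvariantField (hB : IsInnerProductForm B)
    (hT : ∀ X, IsTransposeOf B (adT X) (fun Z => ⁅X, Z⁆))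
    {cov : CovariantDerivative I E (TangentSpace I : G → Type _)}
    (hcov : IsLeviCivita (rightInvariantMetric B) cov) (u v : GroupLieAlgebra I G) (x : G) :
    cov (rightInvariantField v) x (rightInvariantField u x) =
      rightInvariantField (algNabla adT u v) x := by
  have key : (fun u v => rightTriv x (cov (rightInvariantField v) x (rightInvariantField u x))) =
      algNabla adT := by
    refine eq_algNabla hB hT (fun u v => ?_) (fun u v w => ?_)
    · have h := hcov.torsion_free _ _ x (mdifferentiableAt_rightInvariantField u x)
        (mdifferentiableAt_rightInvariantField v x)
      rw [mlieBracket_rightInvariantField] at h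
      rw [← map_sub, h, rightTriv_rightInvariantField]
    · have h := hcov.metric (rightInvariantField u) _ _ x
        (mdifferentiableAt_rightInvariantField v x) (mdifferentiableAt_rightInvariantField w x)
      have hc : (fun y : G => rightInvariantMetric B y (rightInvariantField v y)
          (rightInvariantField w y)) = fun _ => B v w := by
        funext y
        rw [rightInvariantMetric, rightTriv_rightInvariantField, rightTriv_rightInvariantField]
      rw [hc, mvfderiv_const, rightInvariantMetric, rightInvariantMetric,
        rightTriv_rightInvariantField, rightTriv_rightInvariantField] at h
      exact h.symm
  rw [← key, rightInvariantField_rightTriv]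

omit [I.Boundaryless] in
/-- The curvature of a right invariant metric in the right trivialization. -/
theorem trivCurvature_eq_algCurvature (hB : IsInnerProductForm B)
    (hT : ∀ X, IsTransposeOf B (adT X) (fun Z => ⁅X, Z⁆))
    {cov : CovariantDerivative I E (TangentSpace I : G → Type _)}
    (hcov : IsLeviCivita (rightInvariantMetric B) cov) (x : G) :
    trivCurvature cov x = algCurvature adT := by
  funext u v w
  have h (u v : GroupLieAlgebra I G) : (fun y : G => cov (rightInvariantField v) y
      (rightInvariantField u y)) = rightInvariantField (algNabla adT u v) :=
    funext fun y => cov_rightInvariantField hB hT hcov u v y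
  rw [trivCurvature, riemannCurvature, h, h, mlieBracket_rightInvariantField,
    cov_rightInvariantField hB hT hcov, cov_rightInvariantField hB hT hcov,
    cov_rightInvariantField hB hT hcov, map_sub, map_sub, rightTriv_rightInvariantField,
    rightTriv_rightInvariantField, rightTriv_rightInvariantField, algCurvature,
    ← neg_one_smul ℝ ⁅u, v⁆, algNabla_smul_left hB hT, neg_one_smul, sub_neg_eq_add]

/-- No continuity of `adT` is assumed. But `⟨∇_u v, w⟩` is continuous in `u` by its explicit
formula, and the pairings separate points, so the graph is closed and the closed graph theorem
applies. Continuity is needed only in the direction `u`. -/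
theorem continuous_algNabla_left (hB : IsInnerProductForm B)
    (hc : Continuous fun p : GroupLieAlgebra I G × GroupLieAlgebra I G => B p.1 p.2)
    (hT : ∀ X, IsTransposeOf B (adT X) (fun Z => ⁅X, Z⁆)) (v : GroupLieAlgebra I G) :
    Continuous fun u => algNabla adT u v := by
  let g : E →ₗ[ℝ] E :=
    { toFun := fun u => algNabla (L := GroupLieAlgebra I G) adT u v
      map_add' := fun u w => algNabla_add_left hB hT u w v
      map_smul' := fun c u => algNabla_smul_left hB hT c u v }
  have hB2 (u w : GroupLieAlgebra I G) :
      B (algNabla adT u v) w = 2⁻¹ * (B v ⁅u, w⁆ + B u ⁅v, w⁆ - B ⁅u, v⁆ w) := by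
    simp [algNabla, hT _ _ _]
  refine g.continuous_of_seq_closed_graph fun s x y hs hy => ?_
  refine hB.ext_left fun w => ?_
  have h1 : Tendsto (fun n => B (g (s n)) w) atTop (𝓝 (B y w)) :=
    ((hc.comp (continuous_id.prodMk continuous_const)).tendsto y).comp hy
  have h2 : Continuous fun u : GroupLieAlgebra I G => B (algNabla adT u v) w := by
    simp_rw [hB2]
    have c1 := hc.comp (continuous_const.prodMk (continuous_lie_left w) : Continuous fun u => (v, ⁅u, w⁆))
    have c2 := hc.comp (continuous_id.prodMk continuous_const : Continuous fun u => (u, ⁅v, w⁆))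
    have c3 := hc.comp ((continuous_lie_left v).prodMk continuous_const : Continuous fun u => (⁅u, v⁆, w))
    exact continuous_const.mul ((c1.add c2).sub c3)
  exact tendsto_nhds_unique h1 ((h2.tendsto x).comp hs)

/-- A right invariant metric for which `ad` has transposes has a Levi-Civita derivative. -/
theorem exists_isLeviCivita (hB : IsInnerProductForm B)
    (hc : Continuous fun p : GroupLieAlgebra I G × GroupLieAlgebra I G => B p.1 p.2)
    (hT : ∀ X, IsTransposeOf B (adT X) (fun Z => ⁅X, Z⁆)) :
    ∃ cov : CovariantDerivative I E (TangentSpace I : G → Type _),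
      IsLeviCivita (rightInvariantMetric B) cov := by
  obtain ⟨T, hTB⟩ := exists_toContinuousBilinear (E := E) B hc
  let N (v : E) : E →L[ℝ] E :=
    { toFun := fun u => algNabla (L := GroupLieAlgebra I G) adT u v
      map_add' := fun u w => algNabla_add_left hB hT u w v
      map_smul' := fun c u => algNabla_smul_left hB hT c u v
      cont := continuous_algNabla_left hB hc hT v }
  have N_add (v w : E) : N (v + w) = N v + N w :=
    ContinuousLinearMap.ext fun u => algNabla_add_right hB hT u v w
  have N_smul (c : ℝ) (v : E) : N (c • v) = c • N v :=
    ContinuousLinearMap.ext fun u => algNabla_smul_right hB hT c u v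
  -- `D` is the derivative read in the right trivialization, the differential plus the algebraic
  -- term; `R` translates back to the point `x`.
  let D (σ : ∀ x : G, TangentSpace I x) (x : G) : E →L[ℝ] E :=
    mvfderiv I (fun z => rightForm z (σ z)) x + (N (rightForm x (σ x))).comp (rightForm x)
  let R (x : G) : E →L[ℝ] E := mfderiv I I (fun y : G => y * x) 1
  let cov (σ : ∀ x : G, TangentSpace I x) (x : G) : TangentSpace I x →L[ℝ] TangentSpace I x :=
    (R x).comp (D σ x)
  have hR (x : G) (w : E) : R x (rightForm x w) = w := rightInvariantField_rightTriv x w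
  have hR' (x : G) (w : E) : rightForm x (R x w) = w := rightTriv_rightInvariantField x w
  have D_add {σ τ : ∀ x : G, TangentSpace I x} {x : G} (hσ : MDiffAt (T% σ) x)
      (hτ : MDiffAt (T% τ) x) : D (σ + τ) x = D σ x + D τ x := by
    have h1 : (fun z => rightForm z ((σ + τ) z)) =
        fun z => rightForm z (σ z) + rightForm z (τ z) :=
      funext fun z => (rightForm z).map_add _ _
    have h2 := mvfderiv_fun_add (mdifferentiableAt_rightForm hσ) (mdifferentiableAt_rightForm hτ)
    refine ContinuousLinearMap.ext fun w => ?_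
    have h3 := DFunLike.congr_fun h2 w
    rw [← h1] at h3
    have h4 : N (rightForm x ((σ + τ) x)) = N (rightForm x (σ x)) + N (rightForm x (τ x)) := by
      rw [← N_add]; exact congrArg N ((rightForm x).map_add _ _)
    have h5 := DFunLike.congr_fun h4 (rightForm (I := I) x w)
    refine (congrArg₂ (fun a b : E => a + b) h3 h5).trans ?_
    exact add_add_add_comm (G := E) _ _ _ _
  have D_leib {σ : ∀ x : G, TangentSpace I x} {g : G → ℝ} {x : G} (hσ : MDiffAt (T% σ) x)
      (hg : MDiffAt g x) (w : E) :
      D (g • σ) x w = g x • D σ x w + mvfderiv I g x w • (rightForm x (σ x) : E) := by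
    have h1 : (fun z => rightForm z ((g • σ) z)) =
        fun z => g z • rightForm z (σ z) :=
      funext fun z => (rightForm z).map_smul (g z) (σ z)
    have h2 := mvfderiv_fun_smul (I := I) hg (mdifferentiableAt_rightForm hσ)
    have h3 := DFunLike.congr_fun h2 w
    rw [← h1] at h3
    have h4 : N (rightForm x ((g • σ) x)) = g x • N (rightForm x (σ x)) := by
      rw [← N_smul]; exact congrArg N ((rightForm x).map_smul _ _)
    have h5 := DFunLike.congr_fun h4 (rightForm (I := I) x w)
    refine (congrArg₂ (fun a b : E => a + b) h3 h5).trans ?_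
    have (a : ℝ) (p q r : E) : (a • p + q) + a • r = a • (p + r) + q := by module
    exact this _ _ _ _
  have hcov : IsCovariantDerivativeOn E cov (univ : Set G) :=
    { add := fun {σ τ x} hσ hτ _ => by
        refine ContinuousLinearMap.ext fun w => ?_
        refine (congrArg (R x) (DFunLike.congr_fun (D_add hσ hτ) w)).trans ?_
        exact (R x).map_add _ _
      leibniz := fun {σ g x} hσ hg _ => by
        refine ContinuousLinearMap.ext fun w => ?_
        refine (congrArg (R x) (D_leib hσ hg w)).trans ?_
        refine ((R x).map_add _ _).trans ?_
        refine congrArg₂ (fun a b : E => a + b) ((R x).map_smul _ _) ?_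
        refine ((R x).map_smul _ _).trans ?_
        exact congrArg (fun a : E => mvfderiv I g x w • a) (hR x (σ x)) }
  refine ⟨⟨cov, hcov⟩, ⟨fun X Y x hX hY => ?_, fun X Y Z x hY hZ => ?_⟩⟩
  -- The Maurer-Cartan term `⁅ω(X), ω(Y)⁆` cancels against the antisymmetric part of `algNabla`.
  · have h1 := rightForm_mlieBracket hX hY
    have h2 := algNabla_sub_swap (L := GroupLieAlgebra I G) adT (rightTriv x (X x)) (rightTriv x (Y x))
    have h3 : (D Y x (X x) - D X x (Y x) : E) = rightForm x (VectorField.mlieBracket I X Y x) := by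
      have (a b c d e f : E) (h : a - b - e = f) (h' : c - d = -f) : (a + c) - (b + d) = e := by
        rw [add_sub_add_comm, h', ← h]; abel
      exact this _ _ _ _ _ _ h1 h2
    refine ((R x).map_sub _ _).symm.trans ?_
    exact (congrArg (R x) h3).trans (hR x _)
  -- In the trivialization the metric is the constant form `T`: the product rule is exact, and the
  -- algebraic terms cancel since `algNabla` is skew.
  · have h1 := mvfderiv_bilinear T (mdifferentiableAt_rightForm hY)
      (mdifferentiableAt_rightForm hZ) (X x)
    have h2 := algNabla_metric hB hT (rightTriv x (X x)) (rightTriv x (Y x)) (rightTriv x (Z x))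
    have h3 : (fun z => T (rightForm z (Y z)) (rightForm z (Z z))) =
        fun z => rightInvariantMetric B z (Y z) (Z z) := funext fun z => hTB _ _
    rw [h3] at h1
    refine h1.trans ?_
    replace h2 := (congrArg₂ (fun a b : ℝ => a + b) (hTB _ _) (hTB _ _)).trans h2
    have h4 (σ τ : ∀ x : G, TangentSpace I x) : rightInvariantMetric B x (cov σ x (X x)) (τ x) =
        T (D σ x (X x)) (rightForm x (τ x)) :=
      (hTB _ _).symm.trans (congrArg (fun a : E => T a (rightForm x (τ x))) (hR' x _))
    have h5 (σ τ : ∀ x : G, TangentSpace I x) : rightInvariantMetric B x (τ x) (cov σ x (X x)) =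
        T (rightForm x (τ x)) (D σ x (X x)) :=
      (hTB _ _).symm.trans (congrArg (fun a : E => T (rightForm x (τ x)) a) (hR' x _))
    refine Eq.trans ?_ (congrArg₂ (fun a b : ℝ => a + b) (h4 Y Z) (h5 Z Y)).symm
    have (a b c d p q : E) (h : T c q + T p d = 0) :
        T a q + T p b = T (a + c) q + T p (b + d) := by
      simp only [map_add, add_apply]; linarith
    exact this _ _ _ _ _ _ h2

end LeviCivita

/-! ### The semidirect product as a Lie group and its adjoint action -/

section SemidirectLieGroup

attribute [local instance] lieGroup_minSmoothness_three

variable {E : Type*} [NormedAddCommGroup E] [NormedSpace ℝ E]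
  {HM : Type*} [TopologicalSpace HM] {I : ModelWithCorners ℝ E HM}
  {F : Type*} [NormedAddCommGroup F] [NormedSpace ℝ F]
  {HN : Type*} [TopologicalSpace HN] {J : ModelWithCorners ℝ F HN}
  {G : Type*} [TopologicalSpace G] [ChartedSpace HM G] [Group G] [LieGroup I ∞ G]
  {H : Type*} [TopologicalSpace H] [ChartedSpace HN H] [Group H] [LieGroup J ∞ H]
  {B : G →* MulAut H}

theorem lieGroup_semidirectGroup
    (hB : ContMDiff (I.prod J) J ∞ (fun p : G × H => B p.1 p.2)) :
    LieGroup (I.prod J) ∞ (SemidirectGroup B) where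
  contMDiff_mul := by
    have h1 : ContMDiff ((I.prod J).prod (I.prod J)) (I.prod J) ∞
        (fun p : (G × H) × (G × H) => (p.1.1 * p.2.1, p.1.2 * B p.1.1 p.2.2)) :=
      ((contMDiff_fst.comp contMDiff_fst).mul (contMDiff_fst.comp contMDiff_snd)).prodMk
        ((contMDiff_snd.comp contMDiff_fst).mul
          (hB.comp ((contMDiff_fst.comp contMDiff_fst).prodMk (contMDiff_snd.comp contMDiff_snd))))
    exact h1
  contMDiff_inv := by
    have h1 : ContMDiff (I.prod J) (I.prod J) ∞
        (fun p : G × H => (p.1⁻¹, B p.1⁻¹ p.2⁻¹)) :=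
      contMDiff_fst.inv.prodMk (hB.comp (contMDiff_fst.inv.prodMk contMDiff_snd.inv))
    exact h1

variable (B) in
/-- The projection of the semidirect product onto the acting group. -/
def semidirectFst : SemidirectGroup B →* G where
  toFun p := p.1
  map_one' := rfl
  map_mul' _ _ := rfl

variable (B) in
/-- The inclusion of the acting group in the semidirect product. -/
def semidirectInl : G →* SemidirectGroup B where
  toFun g := (g, 1)
  map_one' := rfl
  map_mul' g g' := Prod.ext rfl (by
    change (1 : H) = 1 * B g 1
    simp)

variable (B) in
/-- The inclusion of the normal factor in the semidirect product. -/
def semidirectInr : H →* SemidirectGroup B where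
  toFun k := (1, k)
  map_one' := rfl
  map_mul' k k' := Prod.ext (mul_one (1 : G)).symm (by
    change k * k' = k * B 1 k'
    simp)

omit [TopologicalSpace G] [TopologicalSpace H] in
theorem semidirectInl_mul_semidirectInr_mul_inv (g : G) (k : H) :
    semidirectInl B g * semidirectInr B k * (semidirectInl B g)⁻¹ = semidirectInr B (B g k) := by
  rw [mul_inv_eq_iff_eq_mul]
  refine Prod.ext ?_ ?_
  · change g * 1 = 1 * g
    simp
  · change 1 * B g k = B g k * B 1 1
    simp

omit [LieGroup I ∞ G] [LieGroup J ∞ H] in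
theorem contMDiff_semidirectFst : ContMDiff (I.prod J) I ∞ (semidirectFst B) :=
  (contMDiff_fst : ContMDiff (I.prod J) I ∞ (Prod.fst : G × H → G))

omit [LieGroup I ∞ G] [LieGroup J ∞ H] in
theorem contMDiff_semidirectInl : ContMDiff I (I.prod J) ∞ (semidirectInl B) :=
  (contMDiff_id.prodMk contMDiff_const : ContMDiff I (I.prod J) ∞ (fun g : G => (g, (1 : H))))

omit [LieGroup I ∞ G] [LieGroup J ∞ H] in
theorem contMDiff_semidirectInr : ContMDiff J (I.prod J) ∞ (semidirectInr B) :=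
  (contMDiff_const.prodMk contMDiff_id : ContMDiff J (I.prod J) ∞ (fun k : H => ((1 : G), k)))

omit [LieGroup I ∞ G] [LieGroup J ∞ H] in
theorem mfderiv_semidirectFst (p : SemidirectGroup B) (v : E × F) :
    (mfderiv (I.prod J) I (semidirectFst B) p v : E) = v.1 :=
  DFunLike.congr_fun (mfderiv_fst (I := I) (I' := J) (x := (p : G × H))) v

omit [LieGroup I ∞ G] [LieGroup J ∞ H] in
theorem mfderiv_semidirectInl (g : G) (X : E) :
    (mfderiv I (I.prod J) (semidirectInl B) g X : E × F) = (X, 0) :=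
  DFunLike.congr_fun (mfderiv_prod_left (I := I) (I' := J) (x₀ := g) (y₀ := (1 : H))) X

omit [LieGroup I ∞ G] [LieGroup J ∞ H] in
theorem mfderiv_semidirectInr (k : H) (Y : F) :
    (mfderiv J (I.prod J) (semidirectInr B) k Y : E × F) = (0, Y) :=
  DFunLike.congr_fun (mfderiv_prod_right (I := I) (I' := J) (x₀ := (1 : G)) (y₀ := k)) Y

omit [LieGroup I ∞ G] [LieGroup J ∞ H] in
/-- The adjoint action of the first factor on the second one is the linearized action. -/
theorem rightForm_mulInvariantVectorField_semidirect [LieGroup (I.prod J) ∞ (SemidirectGroup B)]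
    (hB : ContMDiff (I.prod J) J ∞ (fun p : G × H => B p.1 p.2)) (g : G)
    (Y : GroupLieAlgebra J H) :
    (rightForm (I := I.prod J) (semidirectInl B g)
      (mulInvariantVectorField (semidirectPair B I J 0 Y) (semidirectInl B g)) : E × F) =
      (0, linearizedAction B J g Y) := by
  have hr (k : H) : MDifferentiableAt J (I.prod J) (semidirectInr B) k :=
    (contMDiff_semidirectInr.mdifferentiable (by simp)) k
  have hg (k : H) : MDifferentiableAt J J (fun y => B g y) k :=
    ((hB.comp (contMDiff_const.prodMk contMDiff_id)).mdifferentiable (by simp)) k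
  set x := semidirectInl B g
  have h1 := mfderiv_comp_apply_of_eq (x := (1 : SemidirectGroup B))
    (mdifferentiableAt_mul_right (I := I.prod J) (a := x⁻¹) (b := x))
    (mdifferentiableAt_mul_left (I := I.prod J) (a := x) (b := 1)) (mul_one x)
    (semidirectPair B I J 0 Y)
  have h2 := mfderiv_comp_apply_of_eq (x := (1 : H))
    ((mdifferentiableAt_mul_right (I := I.prod J) (a := x⁻¹) (b := x)).comp_of_eq
      (x := (1 : SemidirectGroup B))
      (mdifferentiableAt_mul_left (I := I.prod J) (a := x) (b := 1)) (mul_one x))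
    (hr 1) (map_one _) Y
  have h3 := mfderiv_comp_apply_of_eq (x := (1 : H)) (hr 1) (hg 1) (map_one _) Y
  have h4 : ((fun y => y * x⁻¹) ∘ fun y => x * y) ∘ semidirectInr B =
      semidirectInr B ∘ fun k => B g k :=
    funext fun k => semidirectInl_mul_semidirectInr_mul_inv g k
  rw [h4] at h2
  have h5 := mfderiv_semidirectInr (I := I) (J := J) (B := B) 1 Y
  refine h1.symm.trans ?_
  refine (congrArg (mfderiv (I.prod J) (I.prod J) ((fun y => y * x⁻¹) ∘ fun y => x * y) 1)
    h5).symm.trans ?_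
  exact (h2.symm.trans h3).trans (mfderiv_semidirectInr (I := I) (J := J) (B := B) 1 _)

variable [CompleteSpace E] [CompleteSpace F] [I.Boundaryless] [J.Boundaryless]

omit [LieGroup I ∞ G] [LieGroup J ∞ H] in
-- Differentiate `g ↦ Ad(g, 1)(0, Y) = (0, β(g)Y)` at the identity: the derivative of `Ad` is the
-- bracket, that of `β` is `b`.
theorem semidirectTangent_lie_mixed [LieGroup (I.prod J) ∞ (SemidirectGroup B)]
    (hB : ContMDiff (I.prod J) J ∞ (fun p : G × H => B p.1 p.2))
    (X : GroupLieAlgebra I G) (Y : GroupLieAlgebra J H) :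
    (semidirectTangent B I J ⁅semidirectPair B I J X 0, semidirectPair B I J 0 Y⁆).2 =
      infinitesimalAction B I J X Y := by
  have h1 := mvfderiv_rightForm_mulInvariantVectorField (semidirectPair B I J X 0)
    (semidirectPair B I J 0 Y)
  have h2 := mdifferentiableAt_rightForm (mdifferentiableAt_mulInvariantVectorField
    (semidirectPair B I J 0 Y) (g := (1 : SemidirectGroup B)))
  have hl : MDifferentiableAt I (I.prod J) (semidirectInl B) 1 :=
    (contMDiff_semidirectInl.mdifferentiable (by simp)) 1
  have hs := (ContinuousLinearMap.snd ℝ E F).mdifferentiableAt (x := (0, linearizedAction B J 1 Y))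
  have h3 := mfderiv_comp_apply_of_eq (x := (1 : G)) h2 hl (map_one _) X
  have h4 : (fun x : SemidirectGroup B => rightForm (I := I.prod J) x (mulInvariantVectorField
      (semidirectPair B I J 0 Y) x)) ∘ semidirectInl B =
      fun g => ((0, linearizedAction B J g Y) : E × F) :=
    funext fun g => rightForm_mulInvariantVectorField_semidirect hB g Y
  -- Differentiability of `g ↦ (0, β(g)Y)` is inherited from the adjoint orbit along `G`.
  have h5 := h2.comp_of_eq (x := (1 : G)) hl (map_one _)
  rw [h4] at h3 h5
  have h6 := mfderiv_comp_apply (x := (1 : G)) hs h5 X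
  rw [ContinuousLinearMap.mfderiv_eq] at h6
  refine Eq.trans ?_ h6.symm
  refine congrArg Prod.snd (α := E × F) ?_
  refine h1.symm.trans (Eq.trans ?_ h3.symm)
  exact congrArg (mvfderiv (I.prod J) (fun x : SemidirectGroup B => rightForm (I := I.prod J) x
    (mulInvariantVectorField (semidirectPair B I J 0 Y) x)) 1)
    (mfderiv_semidirectInl (I := I) (J := J) (B := B) 1 X).symm

end SemidirectLieGroup

/-! ### The bracket and the metric of the semidirect product -/

section SemidirectBracket

attribute [local instance] lieGroup_minSmoothness_three

variable {E : Type*} [NormedAddCommGroup E] [NormedSpace ℝ E] [CompleteSpace E]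
  {HM : Type*} [TopologicalSpace HM] {I : ModelWithCorners ℝ E HM} [I.Boundaryless]
  {F : Type*} [NormedAddCommGroup F] [NormedSpace ℝ F] [CompleteSpace F]
  {HN : Type*} [TopologicalSpace HN] {J : ModelWithCorners ℝ F HN} [J.Boundaryless]
  {G : Type*} [TopologicalSpace G] [ChartedSpace HM G] [Group G] [LieGroup I ∞ G]
  {H : Type*} [TopologicalSpace H] [ChartedSpace HN H] [Group H] [LieGroup J ∞ H]
  {B : G →* MulAut H}

/-- The Lie bracket of the semidirect product. -/
theorem semidirectTangent_lie [LieGroup (I.prod J) ∞ (SemidirectGroup B)]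
    (hB : ContMDiff (I.prod J) J ∞ (fun p : G × H => B p.1 p.2))
    (u v : GroupLieAlgebra (I.prod J) (SemidirectGroup B)) :
    semidirectTangent B I J ⁅u, v⁆ =
      (⁅(semidirectTangent B I J u).1, (semidirectTangent B I J v).1⁆,
        ⁅(semidirectTangent B I J u).2, (semidirectTangent B I J v).2⁆ +
          infinitesimalAction B I J (semidirectTangent B I J u).1 (semidirectTangent B I J v).2 -
          infinitesimalAction B I J (semidirectTangent B I J v).1
            (semidirectTangent B I J u).2) := by
  refine Prod.ext ?_ ?_
  · refine (mfderiv_semidirectFst (I := I) (J := J) (1 : SemidirectGroup B)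
      (⁅u, v⁆ : GroupLieAlgebra (I.prod J) (SemidirectGroup B))).symm.trans ?_
    exact mfderiv_lie (semidirectFst B) contMDiff_semidirectFst
      (mfderiv_semidirectFst (I := I) (J := J) (1 : SemidirectGroup B) u)
      (mfderiv_semidirectFst (I := I) (J := J) (1 : SemidirectGroup B) v)
  -- By bilinearity it is enough to bracket pure elements. The inclusions of `G` and `H` are
  -- homomorphisms and give the unmixed brackets. The projection to `H` is not one, so this
  -- component needs the mixed bracket.
  · have split (w : GroupLieAlgebra (I.prod J) (SemidirectGroup B)) :
        w = semidirectPair B I J (semidirectTangent B I J w).1 0 +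
          semidirectPair B I J 0 (semidirectTangent B I J w).2 := by
      simp [semidirectPair, ← map_add]
    have hl (X₁ X₂ : GroupLieAlgebra I G) : (semidirectTangent B I J
        ⁅semidirectPair B I J X₁ 0, semidirectPair B I J X₂ 0⁆).2 = 0 :=
      congrArg Prod.snd ((mfderiv_lie (semidirectInl B) contMDiff_semidirectInl
        (mfderiv_semidirectInl (I := I) (J := J) (B := B) 1 X₁)
        (mfderiv_semidirectInl (I := I) (J := J) (B := B) 1 X₂)).symm.trans
        (mfderiv_semidirectInl (I := I) (J := J) (B := B) 1
          (⁅X₁, X₂⁆ : GroupLieAlgebra I G)))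
    have hr (Y₁ Y₂ : GroupLieAlgebra J H) : (semidirectTangent B I J
        ⁅semidirectPair B I J 0 Y₁, semidirectPair B I J 0 Y₂⁆).2 = ⁅Y₁, Y₂⁆ :=
      congrArg Prod.snd ((mfderiv_lie (semidirectInr B) contMDiff_semidirectInr
        (mfderiv_semidirectInr (I := I) (J := J) (B := B) 1 Y₁)
        (mfderiv_semidirectInr (I := I) (J := J) (B := B) 1 Y₂)).symm.trans
        (mfderiv_semidirectInr (I := I) (J := J) (B := B) 1
          (⁅Y₁, Y₂⁆ : GroupLieAlgebra J H)))
    have hm (X : GroupLieAlgebra I G) (Y : GroupLieAlgebra J H) : (semidirectTangent B I J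
        ⁅semidirectPair B I J 0 Y, semidirectPair B I J X 0⁆).2 =
        -infinitesimalAction B I J X Y := by
      rw [← semidirectTangent_lie_mixed hB, ← lie_skew, map_neg, Prod.snd_neg]
    conv_lhs => rw [split u, split v]
    rw [add_lie, lie_add, lie_add, map_add, map_add, map_add, Prod.snd_add, Prod.snd_add,
      Prod.snd_add, hl, hr, hm, semidirectTangent_lie_mixed hB]
    abel_nf

omit [CompleteSpace E] [I.Boundaryless] [CompleteSpace F] [J.Boundaryless] [LieGroup I ∞ G]
  [LieGroup J ∞ H] in
theorem continuous_semidirectForm {ipG : LinearMap.BilinForm ℝ (GroupLieAlgebra I G)}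
    {ipH : LinearMap.BilinForm ℝ (GroupLieAlgebra J H)}
    (hG : Continuous fun p : GroupLieAlgebra I G × GroupLieAlgebra I G => ipG p.1 p.2)
    (hH : Continuous fun p : GroupLieAlgebra J H × GroupLieAlgebra J H => ipH p.1 p.2) :
    Continuous fun p : GroupLieAlgebra (I.prod J) (SemidirectGroup B) ×
      GroupLieAlgebra (I.prod J) (SemidirectGroup B) => semidirectForm B ipG ipH p.1 p.2 := by
  have h1 : Continuous fun p : (E × F) × (E × F) => (p.1.1, p.2.1) := by fun_prop
  have h2 : Continuous fun p : (E × F) × (E × F) => (p.1.2, p.2.2) := by fun_prop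
  exact (hG.comp h1).add (hH.comp h2)

end SemidirectBracket

/-! ### The theorem for Lie groups and for Lie algebras -/

theorem corollary3 :
    -- Lie groups modelled on Banach spaces
    (∀ {E : Type*} [NormedAddCommGroup E] [NormedSpace ℝ E] [CompleteSpace E]
      {F : Type*} [NormedAddCommGroup F] [NormedSpace ℝ F] [CompleteSpace F]
      {G : Type*} [TopologicalSpace G] [ChartedSpace E G] [Group G] [LieGroup 𝓘(ℝ, E) ∞ G]
      {H : Type*} [TopologicalSpace H] [ChartedSpace F H] [Group H] [LieGroup 𝓘(ℝ, F) ∞ H]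
      (B : G →* MulAut H)
      (_ : ContMDiff (𝓘(ℝ, E).prod 𝓘(ℝ, F)) 𝓘(ℝ, F) ∞ (fun p : G × H => B p.1 p.2))
      -- bounded inner products on the Lie algebras
      (ipG : LinearMap.BilinForm ℝ (GroupLieAlgebra 𝓘(ℝ, E) G))
      (_ : IsInnerProductForm ipG)
      (_ : Continuous fun p : GroupLieAlgebra 𝓘(ℝ, E) G × GroupLieAlgebra 𝓘(ℝ, E) G => ipG p.1 p.2)
      (ipH : LinearMap.BilinForm ℝ (GroupLieAlgebra 𝓘(ℝ, F) H))
      (_ : IsInnerProductForm ipH)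
      (_ : Continuous fun p : GroupLieAlgebra 𝓘(ℝ, F) H × GroupLieAlgebra 𝓘(ℝ, F) H => ipH p.1 p.2)
      -- transposes of `ad X`, `ad Y`, `b(X)`, and the map `h`
      (adTG : GroupLieAlgebra 𝓘(ℝ, E) G → GroupLieAlgebra 𝓘(ℝ, E) G → GroupLieAlgebra 𝓘(ℝ, E) G)
      (_ : ∀ X, IsTransposeOf ipG (adTG X) (fun Z => ⁅X, Z⁆))
      (adTH : GroupLieAlgebra 𝓘(ℝ, F) H → GroupLieAlgebra 𝓘(ℝ, F) H → GroupLieAlgebra 𝓘(ℝ, F) H)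
      (_ : ∀ Y, IsTransposeOf ipH (adTH Y) (fun Z => ⁅Y, Z⁆))
      (bT : GroupLieAlgebra 𝓘(ℝ, E) G → GroupLieAlgebra 𝓘(ℝ, F) H → GroupLieAlgebra 𝓘(ℝ, F) H)
      (_ : ∀ X, IsTransposeOf ipH (bT X) (infinitesimalAction B 𝓘(ℝ, E) 𝓘(ℝ, F) X))
      (h : GroupLieAlgebra 𝓘(ℝ, F) H →ₗ[ℝ] GroupLieAlgebra 𝓘(ℝ, F) H →ₗ[ℝ] GroupLieAlgebra 𝓘(ℝ, E) G)
      (_ : ∀ X Y₁ Y₂, ipH (infinitesimalAction B 𝓘(ℝ, E) 𝓘(ℝ, F) X Y₁) Y₂ = ipG (h Y₁ Y₂) X),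
      -- the Levi-Civita covariant derivatives exist, and the curvature formulas hold for them
      (∃ nablaG : CovariantDerivative 𝓘(ℝ, E) E (TangentSpace 𝓘(ℝ, E) : G → Type _),
        IsLeviCivita (rightInvariantMetric ipG) nablaG) ∧
      (∃ nablaH : CovariantDerivative 𝓘(ℝ, F) F (TangentSpace 𝓘(ℝ, F) : H → Type _),
        IsLeviCivita (rightInvariantMetric ipH) nablaH) ∧
      (∃ nablaS : CovariantDerivative (𝓘(ℝ, E).prod 𝓘(ℝ, F)) (E × F)
          (TangentSpace (𝓘(ℝ, E).prod 𝓘(ℝ, F)) : SemidirectGroup B → Type _),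
        IsLeviCivita (rightInvariantMetric (semidirectForm B ipG ipH)) nablaS) ∧
      ∀ (nablaG : CovariantDerivative 𝓘(ℝ, E) E (TangentSpace 𝓘(ℝ, E) : G → Type _))
        (nablaH : CovariantDerivative 𝓘(ℝ, F) F (TangentSpace 𝓘(ℝ, F) : H → Type _))
        (nablaS : CovariantDerivative (𝓘(ℝ, E).prod 𝓘(ℝ, F)) (E × F)
          (TangentSpace (𝓘(ℝ, E).prod 𝓘(ℝ, F)) : SemidirectGroup B → Type _)),
        IsLeviCivita (rightInvariantMetric ipG) nablaG →
        IsLeviCivita (rightInvariantMetric ipH) nablaH →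
        IsLeviCivita (rightInvariantMetric (semidirectForm B ipG ipH)) nablaS →
        ∀ (x : G) (y : H) (p : SemidirectGroup B),
          SemidirectCurvatureFormulas ipG (trivCurvature nablaG x) ipH (trivCurvature nablaH y)
            (semidirectForm B ipG ipH) (trivCurvature nablaS p)
            (semidirectPair B 𝓘(ℝ, E) 𝓘(ℝ, F)) adTG (infinitesimalAction B 𝓘(ℝ, E) 𝓘(ℝ, F)) bT h) ∧
    -- arbitrary Lie algebras, with the curvature of right invariant metrics expressed in them
    (∀ {𝔤 : Type*} [LieRing 𝔤] [LieAlgebra ℝ 𝔤] {𝔥 : Type*} [LieRing 𝔥] [LieAlgebra ℝ 𝔥]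
      (b : 𝔤 →ₗ⁅ℝ⁆ LieDerivation ℝ 𝔥 𝔥)
      (ipG : LinearMap.BilinForm ℝ 𝔤) (_ : IsInnerProductForm ipG)
      (ipH : LinearMap.BilinForm ℝ 𝔥) (_ : IsInnerProductForm ipH)
      (adTG : 𝔤 → 𝔤 → 𝔤) (_ : ∀ X, IsTransposeOf ipG (adTG X) (fun Z => ⁅X, Z⁆))
      (adTH : 𝔥 → 𝔥 → 𝔥) (_ : ∀ Y, IsTransposeOf ipH (adTH Y) (fun Z => ⁅Y, Z⁆))
      (bT : 𝔤 → 𝔥 → 𝔥) (_ : ∀ X, IsTransposeOf ipH (bT X) (fun Y => b X Y))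
      (h : 𝔥 →ₗ[ℝ] 𝔥 →ₗ[ℝ] 𝔤) (_ : ∀ X Y₁ Y₂, ipH (b X Y₁) Y₂ = ipG (h Y₁ Y₂) X),
      (∃ adTS : (𝔥 ⋊⁅b⁆ 𝔤) → (𝔥 ⋊⁅b⁆ 𝔤) → (𝔥 ⋊⁅b⁆ 𝔤),
        ∀ U, IsTransposeOf (algForm b ipG ipH) (adTS U) (fun Z => ⁅U, Z⁆)) ∧
      ∀ adTS : (𝔥 ⋊⁅b⁆ 𝔤) → (𝔥 ⋊⁅b⁆ 𝔤) → (𝔥 ⋊⁅b⁆ 𝔤),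
        (∀ U, IsTransposeOf (algForm b ipG ipH) (adTS U) (fun Z => ⁅U, Z⁆)) →
          SemidirectCurvatureFormulas ipG (algCurvature adTG) ipH (algCurvature adTH)
            (algForm b ipG ipH) (algCurvature adTS) (algPair b) adTG (fun X Y => b X Y) bT h) := by
  refine ⟨?_, ?_⟩
  · intro E _ _ _ F _ _ _ G _ _ _ _ H _ _ _ _ B hB ipG hG hGc ipH hH hHc adTG hTG adTH hTH bT hbT
      h hh
    have := lieGroup_semidirectGroup hB
    have := lieGroup_minSmoothness_three (I := 𝓘(ℝ, E)) (G := G)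
    have := lieGroup_minSmoothness_three (I := 𝓘(ℝ, F)) (G := H)
    have := lieGroup_minSmoothness_three (I := 𝓘(ℝ, E).prod 𝓘(ℝ, F)) (G := SemidirectGroup B)
    have hS : IsInnerProductForm (semidirectForm B ipG ipH) :=
      (hG.orthogonalSum hH).comp_equiv (semidirectTangent B 𝓘(ℝ, E) 𝓘(ℝ, F))
    have hbr := semidirectTangent_lie (I := 𝓘(ℝ, E)) (J := 𝓘(ℝ, F)) hB
    -- The explicit transpose serves twice: for the existence of the Levi-Civita derivative on `G ⋉
    -- H` and for its curvature.
    have hTS := isTransposeOf_semidirect (ipS := semidirectForm B ipG ipH) (fun _ _ => rfl) hbr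
      hH hTG hTH hbT hh
    refine ⟨exists_isLeviCivita hG hGc hTG, exists_isLeviCivita hH hHc hTH,
      exists_isLeviCivita hS (continuous_semidirectForm hGc hHc) hTS, ?_⟩
    intro nablaG nablaH nablaS hnG hnH hnS x y p
    rw [trivCurvature_eq_algCurvature hG hTG hnG, trivCurvature_eq_algCurvature hH hTH hnH,
      trivCurvature_eq_algCurvature hS hTS hnS]
    exact semidirectCurvatureFormulas (fun _ _ => rfl) hbr hG hH hS hTG hTH hTS hbT hh
  · intro 𝔤 _ _ 𝔥 _ _ b ipG hG ipH hH adTG hTG adTH hTH bT hbT h hh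
    -- The semidirect sum lists the ideal `𝔥` first, hence the swap, and `add_comm` for the form
    -- below.
    let e : (𝔥 ⋊⁅b⁆ 𝔤) ≃ₗ[ℝ] 𝔤 × 𝔥 :=
      (LieAlgebra.SemiDirectSum.toProdl b).trans (LinearEquiv.prodComm ℝ 𝔥 𝔤)
    have hS : IsInnerProductForm (algForm b ipG ipH) :=
      (hH.orthogonalSum hG).comp_equiv (LieAlgebra.SemiDirectSum.toProdl b)
    have hSe (u v : 𝔥 ⋊⁅b⁆ 𝔤) : algForm b ipG ipH u v =
        ipG (e u).1 (e v).1 + ipH (e u).2 (e v).2 := add_comm _ _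
    have hbr (u v : 𝔥 ⋊⁅b⁆ 𝔤) : e ⁅u, v⁆ = (⁅(e u).1, (e v).1⁆,
        ⁅(e u).2, (e v).2⁆ + b (e u).1 (e v).2 - b (e v).1 (e u).2) := rfl
    exact ⟨⟨_, isTransposeOf_semidirect (b := fun X Y => b X Y) hSe hbr hH hTG hTH hbT hh⟩,
      fun adTS hTS => semidirectCurvatureFormulas (b := fun X Y => b X Y) hSe hbr hG hH hS hTG hTH
        hTS hbT hh⟩
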